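/- Let $\mathcal H_2^+$ be the set of complex Hermitian positive definite $2\times 2$ matrices, and for a Hermitian $X=(x_{jk})$ let $dX=dx_{11}\,dx_{22}\,d\Re(x_{12})\,d\Im(x_{12})$. Write $|X|=\det X$, $\mathrm{tr}^p(X)=(\mathrm{tr}X)^p$, $\mathrm{etr}(X)=e^{\mathrm{tr}X}$, $(a)_n=a(a+1)\cdots(a+n-1)$, $\tilde\Gamma_2(a)=\pi\,\Gamma(a)\Gamma(a-1)$, and let $\mathcal C_n^\nu$ be the Gegenbauer polynomial, $\mathcal C_n^\nu(x)=\sum_{k=0}^{\lfloor n/2\rfloor}(-1)^k\frac{(\nu)_{n-k}}{k!\,(n-2k)!}(2x)^{n-2k}$. Let $A,B\in\mathcal H_2^+$, let $p,t\ge 0$ be integers and let $a\in\mathbb C$ with $\Re(a)>1$. Then the following integral converges absolutely, and $$\int_{\mathcal H_2^+}\mathrm{etr}(-AX)\,\mathrm{tr}^p(BX)\,\mathrm{tr}^t(X)\,|X|^{a-2}\,dX = p!\,t!\,|A|^{-a}\,\tilde\Gamma_2(a)\sum_{t_1=\lceil t/2\rceil}^{t}\frac{(a)_{t_1}(a-1)_{t-t_1}(2t_1+1-t)}{(t_1+1)!\,(t-t_1)!}\sum_{i=0}^{\lceil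 (2t_1-t-1)/2\rceil}\mathcal B_{\tau,p,i},$$ where $\tau=(t_1,t-t_1)$, $\varepsilon_{t_1,i}=2t_1-t-2i$, $\varepsilon_{t_1}=t_1-i$, $$\mathcal B_{\tau,p,i}=\sum_{k=0}^{\min(p,\varepsilon_{t_1,i})}(-1)^{k+i}4^i e_i^\tau\binom{\varepsilon_{t_1,i}}{k}\mathrm{tr}^{\varepsilon_{t_1,i}-k}(A)\,\mathrm{tr}^k(B)\,|A|^{-\varepsilon_{t_1}-\frac{p-k}{2}}\,|B|^{\frac{p-k}{2}}\;\mathcal C_{p-k}^{\varepsilon_{t_1}+a}\!\left(\frac{\mathrm{tr}(A^{-1}B)}{2\sqrt{|A^{-1}B|}}\right),$$ and $e_i^\tau$ is the $i$-th elementary symmetric function of the numbers $\cos^2\!\left(\frac{j\pi}{2t_1-t+1}\right)$, $1\le j\le\left\lceil\frac{2t_1-t-1}{2}\right\rceil$ (with $e_0^\tau=1$). -/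

import Mathlib

open scoped ComplexOrder

noncomputable section

/-- The Hermitian `2 × 2` matrix with diagonal entries `v.1`, `v.2.1` and upper right entry `v.2.2`.
This is a linear bijection of `ℝ × ℝ × ℂ` onto the Hermitian `2 × 2` matrices, and
`dX = dx₁₁ dx₂₂ dRe(x₁₂) dIm(x₁₂)` is Lebesgue measure (`volume`) in these coordinates. -/
def hermTwo (v : ℝ × ℝ × ℂ) : Matrix (Fin 2) (Fin 2) ℂ :=
  !![(v.1 : ℂ), v.2.2; star v.2.2, (v.2.1 : ℂ)]

/-- The cone of Hermitian positive definite `2 × 2` matrices, in the coordinates `hermTwo`. -/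
def posDefTwo : Set (ℝ × ℝ × ℂ) := {v | (hermTwo v).PosDef}

/-- `etr(M) = exp(tr M)`. -/
def etr (M : Matrix (Fin 2) (Fin 2) ℂ) : ℂ := Complex.exp M.trace

/-- The rising factorial `(a)ₙ = a (a + 1) ⋯ (a + n - 1)`. -/
def pochhammer (a : ℂ) (n : ℕ) : ℂ := ∏ j ∈ Finset.range n, (a + j)

/-- The complex multivariate gamma function `π ^ (m (m - 1) / 2) ∏_{j = 1}^m Γ(a - j + 1)`. -/
def complexMultivariateGamma (m : ℕ) (a : ℂ) : ℂ :=
  (Real.pi : ℂ) ^ (m * (m - 1) / 2) * ∏ j ∈ Finset.Icc 1 m, Complex.Gamma (a - j + 1)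

/-- The Gegenbauer (ultraspherical) polynomial
`Cₙ^ν(x) = ∑_{k ≤ n / 2} (-1) ^ k (ν)_{n - k} / (k! (n - 2 k)!) (2 x) ^ (n - 2 k)`. -/
def gegenbauer (n : ℕ) (ν x : ℂ) : ℂ :=
  ∑ k ∈ Finset.range (n / 2 + 1),
    (-1) ^ k * pochhammer ν (n - k) / ((k.factorial : ℂ) * ((n - 2 * k).factorial : ℂ)) *
      (2 * x) ^ (n - 2 * k)

/-- `⌈(2 t₁ - t - 1) / 2⌉`, which is a natural number when `t ≤ 2 t₁`. -/
def ceilBound (t t₁ : ℕ) : ℕ := ⌈(2 * (t₁ : ℝ) - t - 1) / 2⌉₊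

/-- The `i`-th elementary symmetric function of the numbers `cos² (j π / (2 t₁ - t + 1))`,
`1 ≤ j ≤ ⌈(2 t₁ - t - 1) / 2⌉`. -/
def cosEsymm (t t₁ i : ℕ) : ℝ :=
  ((Finset.Icc 1 (ceilBound t t₁)).val.map
    (fun j : ℕ => Real.cos (j * Real.pi / (2 * (t₁ : ℝ) - t + 1)) ^ 2)).esymm i

/-- The term `𝓑_{τ, p, i}` for `τ = (t₁, t - t₁)`, with
`ε_{t₁, i} = 2 t₁ - t - 2 i` and `ε_{t₁} = t₁ - i`. -/
def termB (A B : Matrix (Fin 2) (Fin 2) ℂ) (a : ℂ) (p t t₁ i : ℕ) : ℂ :=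
  ∑ k ∈ Finset.range (min p (2 * t₁ - t - 2 * i) + 1),
    (-1) ^ (k + i) * 4 ^ i * (cosEsymm t t₁ i : ℂ) * ((2 * t₁ - t - 2 * i).choose k : ℂ) *
      A.trace ^ (2 * t₁ - t - 2 * i - k) * B.trace ^ k *
      A.det ^ (-((t₁ : ℂ) - i) - ((p : ℂ) - k) / 2) * B.det ^ (((p : ℂ) - k) / 2) *
      gegenbauer (p - k) ((t₁ : ℂ) - i + a)
        ((A⁻¹ * B).trace / (2 * (A⁻¹ * B).det ^ (1 / 2 : ℂ)))

end

/-! The starting point is the gamma integral over the cone: for `U` in the cone, `∫ etr(-UX)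
|X|^(a-2) dX` equals `Γ̃₂(a) |U|^(-a)`. It is a generating function. Replacing `U` by `U - zC` with
`C` in the cone and expanding in a small real `z`, the coefficient of `z^n` on the left is `1/n!`
times the integral with the extra factor `tr^n(CX)` (`hasSum_moments`), and uniqueness of power
series (`coeff_eq_of_hasSum`) identifies it with the coefficient on the right. This is done twice.

For `C = I`, the right side is `|U|^(-a) (1-αz)^(-a) (1-βz)^(-a)`, where `α`, `β` are the
eigenvalues of `U⁻¹`. Its coefficients are rewritten in the Schur polynomials `(αβ)^s ∑ α^j
β^(t-2s-j)`, `s = t - t₁` (`sum_pochhammer_mul_pochhammer`). The complete homogeneous sum is a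
Chebyshev polynomial of the second kind; factoring it over its roots gives a polynomial in `tr U`
and `|U|` whose coefficients are elementary symmetric functions of squared cosines
(`sum_pow_mul_pow_eq_sum_cosEsymm`).

The result is a combination of terms `tr^m(U) |U|^(-ν)`. For `C = B`, `tr^m(U - zB)` expands by the
binomial theorem and `|U - zB|^(-ν)` by the Gegenbauer generating function
(`hasSum_gegenbauerForm`); the coefficient of `z^p` of their product is the inner sum over `k`. -/

section

open MeasureTheory

/-! ### Hermitian matrices and the cone in real coordinates -/

/-- The determinant of `hermTwo v`, as a real number. -/
def hermDet (v : ℝ × ℝ × ℂ) : ℝ := v.1 * v.2.1 - Complex.normSq v.2.2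

/-- The trace of `hermTwo u * hermTwo v`, as a real number. -/
def hermPairing (u v : ℝ × ℝ × ℂ) : ℝ :=
  u.1 * v.1 + u.2.1 * v.2.1 + 2 * (u.2.2.re * v.2.2.re + u.2.2.im * v.2.2.im)

theorem det_hermTwo (v : ℝ × ℝ × ℂ) : (hermTwo v).det = (hermDet v : ℂ) := by
  simp [hermTwo, hermDet, Matrix.det_fin_two, Complex.mul_conj]

theorem trace_hermTwo (v : ℝ × ℝ × ℂ) : (hermTwo v).trace = ((v.1 + v.2.1 : ℝ) : ℂ) := by
  simp [hermTwo, Matrix.trace_fin_two]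

theorem trace_hermTwo_mul (u v : ℝ × ℝ × ℂ) :
    (hermTwo u * hermTwo v).trace = (hermPairing u v : ℂ) := by
  simp only [hermTwo, hermPairing, Matrix.trace_fin_two, Matrix.mul_apply, Fin.sum_univ_two]
  apply Complex.ext <;> simp <;> ring

theorem exists_hermTwo_eq {A : Matrix (Fin 2) (Fin 2) ℂ} (hA : A.IsHermitian) :
    ∃ u, A = hermTwo u := by
  refine ⟨((A 0 0).re, (A 1 1).re, A 0 1), ?_⟩
  have h0 := hA.apply 0 0
  have h1 := hA.apply 1 1
  have h2 := hA.apply 0 1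
  ext i j
  fin_cases i <;> fin_cases j
  · simpa [hermTwo] using (Complex.conj_eq_iff_re.1 h0).symm
  · simp [hermTwo]
  · simp only [hermTwo]; simpa using h2 ▸ (by simp)
  · simpa [hermTwo] using (Complex.conj_eq_iff_re.1 h1).symm

/-- Sylvester's criterion; the converse completes the square in the quadratic form. -/
theorem mem_posDefTwo_iff (v : ℝ × ℝ × ℂ) : v ∈ posDefTwo ↔ 0 < v.1 ∧ 0 < hermDet v := by
  constructor
  · intro h
    have h : (hermTwo v).PosDef := h
    refine ⟨?_, ?_⟩
    · have := h.diag_pos (i := 0)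
      simpa [hermTwo] using this
    · have := h.det_pos
      rw [det_hermTwo] at this
      exact_mod_cast this
  · rintro ⟨h1, h2⟩
    refine Matrix.PosDef.of_dotProduct_mulVec_pos ?_ ?_
    · ext i j
      fin_cases i <;> fin_cases j <;> simp [hermTwo]
    · intro x hx
      have key : star x ⬝ᵥ (hermTwo v).mulVec x =
          (((Complex.normSq (v.1 * x 0 + v.2.2 * x 1) + hermDet v * Complex.normSq (x 1)) / v.1 : ℝ) : ℂ) := by
        have h1' : (v.1 : ℂ) ≠ 0 := by exact_mod_cast h1.ne'
        push_cast
        rw [eq_div_iff h1', Complex.normSq_eq_conj_mul_self, Complex.normSq_eq_conj_mul_self, hermDet]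
        push_cast
        rw [Complex.normSq_eq_conj_mul_self]
        simp [hermTwo, Matrix.mulVec, dotProduct, Fin.sum_univ_two]
        ring
      rw [key]
      have : 0 < Complex.normSq (v.1 * x 0 + v.2.2 * x 1) + hermDet v * Complex.normSq (x 1) := by
        by_cases hx1 : x 1 = 0
        · have hx0 : x 0 ≠ 0 := by
            intro h; apply hx; ext i; fin_cases i <;> simp [h, hx1]
          have : (v.1 : ℂ) ≠ 0 := by exact_mod_cast h1.ne'
          simp only [hx1, mul_zero, add_zero, Complex.normSq_zero]
          exact Complex.normSq_pos.2 (mul_ne_zero this hx0)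
        · have := mul_pos h2 (Complex.normSq_pos.2 hx1)
          have := Complex.normSq_nonneg (v.1 * x 0 + v.2.2 * x 1)
          linarith
      exact_mod_cast div_pos this h1

theorem isOpen_posDefTwo : IsOpen posDefTwo := by
  have : posDefTwo = {v | 0 < v.1} ∩ {v | 0 < hermDet v} := by
    ext v; exact mem_posDefTwo_iff v
  rw [this]
  refine (isOpen_lt continuous_const (by fun_prop)).inter (isOpen_lt continuous_const ?_)
  unfold hermDet
  have := Complex.continuous_normSq
  fun_prop

theorem measurable_hermDet : Measurable hermDet := by
  unfold hermDet
  have := Complex.continuous_normSq.measurable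
  fun_prop

theorem measurable_hermPairing (u : ℝ × ℝ × ℂ) : Measurable (hermPairing u) := by
  unfold hermPairing
  fun_prop

theorem hermPairing_sub_smul (u b v : ℝ × ℝ × ℂ) (z : ℝ) :
    hermPairing (u - z • b) v = hermPairing u v - z * hermPairing b v := by
  simp [hermPairing]; ring

theorem hermPairing_pos {u v : ℝ × ℝ × ℂ} (hu : u ∈ posDefTwo) (hv : v ∈ posDefTwo) :
    0 < hermPairing u v := by
  rw [mem_posDefTwo_iff] at hu hv
  obtain ⟨hu1, hu2⟩ := hu
  obtain ⟨hv1, hv2⟩ := hv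
  obtain ⟨x, y, w⟩ := u
  obtain ⟨x', y', w'⟩ := v
  simp only [hermDet, hermPairing, Complex.normSq_apply] at *
  obtain ⟨p, q⟩ := w
  obtain ⟨p', q'⟩ := w'
  dsimp only at *
  -- After multiplication by the positive number `x * x'`, the pairing is a sum of nonnegative
  -- terms, of which the product of the two determinants is strictly positive.
  have key : x * x' * (x * x' + y * y' + 2 * (p * p' + q * q')) =
      (x * x' + (p * p' + q * q')) ^ 2 + (p * q' - q * p') ^ 2
      + (x * y - (p * p + q * q)) * (x' * y' - (p' * p' + q' * q'))
      + (x * y - (p * p + q * q)) * (p' ^ 2 + q' ^ 2)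
      + (x' * y' - (p' * p' + q' * q')) * (p ^ 2 + q ^ 2) := by
    ring
  have hpos : 0 < x * x' * (x * x' + y * y' + 2 * (p * p' + q * q')) := by
    rw [key]
    positivity
  exact pos_of_mul_pos_right hpos (by positivity)

theorem eventually_sub_smul_mem {u : ℝ × ℝ × ℂ} (hu : u ∈ posDefTwo) (b : ℝ × ℝ × ℂ) :
    ∀ᶠ z : ℝ in nhds 0, u - z • b ∈ posDefTwo := by
  have hc : Continuous fun z : ℝ => u - z • b := by fun_prop
  exact hc.continuousAt.eventually (isOpen_posDefTwo.mem_nhds (by simpa using hu))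

theorem snd_pos_of_mem {u : ℝ × ℝ × ℂ} (hu : u ∈ posDefTwo) : 0 < u.2.1 := by
  obtain ⟨hu1, hu2⟩ := (mem_posDefTwo_iff u).1 hu
  have := Complex.normSq_nonneg u.2.2
  unfold hermDet at hu2
  exact pos_of_mul_pos_right (by linarith : 0 < u.1 * u.2.1) hu1.le

/-! ### The gamma integral over the cone -/

/-- The second diagonal entry is replaced by the Schur complement. With the other coordinates fixed
this is a translation, so Lebesgue measure is preserved; at `v.1 = 0` the convention `x / 0 = 0`
makes it the identity. The coordinates are swapped to put the fixed one first. The cone becomes a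
product of half-lines and `ℂ`. -/
theorem measurePreserving_shear :
    MeasurePreserving (fun v : ℝ × ℝ × ℂ => (v.1, v.2.1 - Complex.normSq v.2.2 / v.1, v.2.2))
      volume volume := by
  have hns := Complex.continuous_normSq.measurable
  refine MeasurePreserving.skew_product (g := fun (x : ℝ) (p : ℝ × ℂ) =>
    (p.1 - Complex.normSq p.2 / x, p.2)) (MeasurePreserving.id volume) ?_ ?_
  · simp only [Function.uncurry_def]
    fun_prop
  · refine Filter.Eventually.of_forall fun x => ?_
    have h1 : MeasurePreserving (fun p : ℂ × ℝ => (p.1, p.2 - Complex.normSq p.1 / x))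
        (volume.prod volume) (volume.prod volume) := by
      refine MeasurePreserving.skew_product (g := fun (w : ℂ) (y : ℝ) =>
        y - Complex.normSq w / x) (MeasurePreserving.id volume) ?_ ?_
      · simp only [Function.uncurry_def]
        fun_prop
      · exact Filter.Eventually.of_forall fun w => (measurePreserving_sub_right volume _).map_eq
    exact ((Measure.measurePreserving_swap (μ := volume (α := ℂ)) (ν := volume (α := ℝ))).comp
      (h1.comp (Measure.measurePreserving_swap (μ := volume (α := ℝ)) (ν := volume (α := ℂ))))).map_eq

noncomputable section

/-- The integrand of the gamma integral over the positive definite cone. -/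
def gammaIntegrand (u : ℝ × ℝ × ℂ) (a : ℂ) (v : ℝ × ℝ × ℂ) : ℂ :=
  Complex.exp (-(hermPairing u v : ℂ)) * (hermDet v : ℂ) ^ (a - 2)

/-- The gamma integrand in the coordinates `(x, y - |w|² / x, w)`, extended by zero. -/
def shearedIntegrand (u : ℝ × ℝ × ℂ) (a : ℂ) (v : ℝ × ℝ × ℂ) : ℂ :=
  if 0 < v.1 ∧ 0 < v.2.1 then
    Complex.exp (-(hermPairing u (v.1, v.2.1 + Complex.normSq v.2.2 / v.1, v.2.2) : ℂ)) *
      ((v.1 * v.2.1 : ℝ) : ℂ) ^ (a - 2)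
  else 0

end

theorem measurable_shearedIntegrand (u : ℝ × ℝ × ℂ) (a : ℂ) :
    Measurable (shearedIntegrand u a) := by
  have hns := Complex.continuous_normSq.measurable
  unfold shearedIntegrand
  refine Measurable.ite ?_ ?_ measurable_const
  · exact (measurableSet_lt (f := fun _ : ℝ × ℝ × ℂ => (0 : ℝ)) (g := fun v => v.1)
      measurable_const (by fun_prop)).inter
      (measurableSet_lt (f := fun _ : ℝ × ℝ × ℂ => (0 : ℝ)) (g := fun v => v.2.1)
      measurable_const (by fun_prop))
  · have := (measurable_hermPairing u)
    refine Measurable.mul ?_ (Measurable.pow_const (by fun_prop) _)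
    refine Complex.measurable_exp.comp (Measurable.neg (Complex.measurable_ofReal.comp
      (this.comp ?_)))
    fun_prop

theorem indicator_gammaIntegrand (u : ℝ × ℝ × ℂ) (a : ℂ) :
    posDefTwo.indicator (gammaIntegrand u a) = fun v =>
      shearedIntegrand u a (v.1, v.2.1 - Complex.normSq v.2.2 / v.1, v.2.2) := by
  ext v
  by_cases h1 : 0 < v.1
  · have hd : v.1 * (v.2.1 - Complex.normSq v.2.2 / v.1) = hermDet v := by
      unfold hermDet; field_simp
    have hiff : 0 < v.2.1 - Complex.normSq v.2.2 / v.1 ↔ 0 < hermDet v := by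
      rw [← hd, mul_pos_iff_of_pos_left h1]
    by_cases h2 : 0 < hermDet v
    · rw [Set.indicator_of_mem ((mem_posDefTwo_iff v).2 ⟨h1, h2⟩)]
      simp only [shearedIntegrand, gammaIntegrand]
      rw [if_pos ⟨h1, hiff.2 h2⟩, hd]
      simp
    · rw [Set.indicator_of_notMem fun h => h2 ((mem_posDefTwo_iff v).1 h).2]
      simp only [shearedIntegrand]
      rw [if_neg fun h => h2 (hiff.1 h.2)]
  · rw [Set.indicator_of_notMem fun h => h1 ((mem_posDefTwo_iff v).1 h).1]
    simp only [shearedIntegrand]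
    rw [if_neg fun h => h1 h.1]

/-- Taking norms only replaces `a` by its real part, so the explicit slice integrals also control
the integrals of norms needed for Fubini. -/
theorem norm_shearedIntegrand (u : ℝ × ℝ × ℂ) (a : ℂ) (v : ℝ × ℝ × ℂ) :
    ((‖shearedIntegrand u a v‖ : ℝ) : ℂ) = shearedIntegrand u a.re v := by
  unfold shearedIntegrand
  split_ifs with h
  · have hp : 0 < v.1 * v.2.1 := mul_pos h.1 h.2
    rw [norm_mul, Complex.norm_exp, Complex.norm_cpow_eq_rpow_re_of_pos hp]
    rw [Complex.ofReal_mul, Complex.ofReal_cpow hp.le, Complex.ofReal_exp]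
    simp
  · simp

/-- The gamma integral in one variable, with its convergence. -/
theorem hasIntegral_gamma {a : ℂ} {r : ℝ} (ha : 0 < a.re) (hr : 0 < r) :
    IntegrableOn (fun t : ℝ => (t : ℂ) ^ (a - 1) * Complex.exp (-(r * t))) (Set.Ioi 0) ∧
      ∫ t in Set.Ioi (0 : ℝ), (t : ℂ) ^ (a - 1) * Complex.exp (-(r * t)) =
        (r : ℂ) ^ (-a) * Complex.Gamma a := by
  have h := Complex.integral_cpow_mul_exp_neg_mul_Ioi ha hr
  have hr' : (r : ℂ) ≠ 0 := by exact_mod_cast hr.ne'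
  have e : (1 / (r : ℂ)) ^ a = (r : ℂ) ^ (-a) := by
    rw [one_div, Complex.inv_cpow _ _ (by
      rw [Complex.arg_ofReal_of_nonneg hr.le]; exact Real.pi_pos.ne), Complex.cpow_neg]
  rw [e] at h
  refine ⟨?_, h⟩
  -- A non-integrable function has integral `0` by convention, so a nonzero value proves
  -- integrability.
  refine Integrable.of_integral_ne_zero ?_
  rw [h]
  refine mul_ne_zero ?_ (Complex.Gamma_ne_zero_of_re_pos ha)
  rw [Complex.cpow_def_of_ne_zero hr']
  exact Complex.exp_ne_zero _

/-- At fixed `x` the integrand factors into a gamma integrand of exponent `a - 1` in the Schur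
complement, which is where `1 < a.re` enters, and a Gaussian in the off-diagonal entry. Completing
the square in the Gaussian changes the decay rate in `x` from `u.1` to `hermDet u / u.2.1`. -/
theorem hasIntegral_sheared_slice {u : ℝ × ℝ × ℂ} (hu : u ∈ posDefTwo) {a : ℂ} (ha : 1 < a.re)
    {x : ℝ} (hx : 0 < x) :
    Integrable (fun q : ℝ × ℂ => shearedIntegrand u a (x, q)) ∧
      ∫ q : ℝ × ℂ, shearedIntegrand u a (x, q) =
        (Real.pi * (u.2.1 : ℂ) ^ (-a) * Complex.Gamma (a - 1)) *
          ((x : ℂ) ^ (a - 1) * Complex.exp (-((hermDet u / u.2.1 : ℝ) * x))) := by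
  have hδ := snd_pos_of_mem hu
  obtain ⟨hs, hsi⟩ := hasIntegral_gamma (a := a - 1) (r := u.2.1) (by simpa using ha) hδ
  have hb : 0 < ((u.2.1 / x : ℝ) : ℂ).re := by simpa using div_pos hδ hx
  have hw := GaussianFourier.integrable_cexp_neg_mul_sq_norm_add hb (-2) u.2.2
  have hwi := GaussianFourier.integral_cexp_neg_mul_sq_norm_add hb (-2) u.2.2
  rw [← integrable_indicator_iff measurableSet_Ioi] at hs
  rw [← integral_indicator measurableSet_Ioi] at hsi
  have hx' : (x : ℂ) ≠ 0 := by exact_mod_cast hx.ne'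
  have hδ' : (u.2.1 : ℂ) ≠ 0 := by exact_mod_cast hδ.ne'
  have heq : (fun q : ℝ × ℂ => shearedIntegrand u a (x, q)) = fun q : ℝ × ℂ =>
      ((x : ℂ) ^ (a - 2) * Complex.exp (-(u.1 * x))) *
      ((Set.Ioi 0).indicator (fun t : ℝ => (t : ℂ) ^ (a - 1 - 1) *
        Complex.exp (-(u.2.1 * t))) q.1 *
      Complex.exp (-((u.2.1 / x : ℝ) : ℂ) * ‖q.2‖ ^ 2 + (-2) * (inner ℝ u.2.2 q.2 : ℝ))) := by
    ext q
    simp only [shearedIntegrand]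
    by_cases hq : 0 < q.1
    · rw [if_pos ⟨hx, hq⟩, Set.indicator_of_mem (Set.mem_Ioi.2 hq), Complex.ofReal_mul,
        Complex.mul_cpow_ofReal_nonneg hx.le hq.le, show a - 1 - 1 = a - 2 by ring]
      rw [show ((x : ℂ) ^ (a - 2) * Complex.exp (-(u.1 * x))) *
        ((q.1 : ℂ) ^ (a - 2) * Complex.exp (-(u.2.1 * q.1)) *
        Complex.exp (-((u.2.1 / x : ℝ) : ℂ) * ‖q.2‖ ^ 2 + (-2) * (inner ℝ u.2.2 q.2 : ℝ))) =
        (Complex.exp (-(u.1 * x)) * Complex.exp (-(u.2.1 * q.1)) *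
        Complex.exp (-((u.2.1 / x : ℝ) : ℂ) * ‖q.2‖ ^ 2 + (-2) * (inner ℝ u.2.2 q.2 : ℝ))) *
        ((x : ℂ) ^ (a - 2) * (q.1 : ℂ) ^ (a - 2)) by ring, ← Complex.exp_add, ← Complex.exp_add]
      congr 2
      rw [← Complex.ofReal_pow, ← Complex.normSq_eq_norm_sq]
      simp only [hermPairing, Complex.inner]
      simp
      field_simp
      ring
    · rw [if_neg fun h => hq h.2, Set.indicator_of_notMem (by simpa using hq)]
      simp
  refine ⟨heq ▸ (hs.mul_prod hw).const_mul _, ?_⟩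
  rw [heq, integral_const_mul]
  have := integral_prod_mul (μ := (volume : Measure ℝ)) (ν := (volume : Measure ℂ))
    ((Set.Ioi 0).indicator (fun t : ℝ => (t : ℂ) ^ (a - 1 - 1) *
        Complex.exp (-(u.2.1 * t)))) (fun q : ℂ => 
      Complex.exp (-((u.2.1 / x : ℝ) : ℂ) * ‖q‖ ^ 2 + (-2) * (inner ℝ u.2.2 q : ℝ)))
  rw [← Measure.volume_eq_prod] at this
  rw [this, hsi, hwi, Complex.finrank_real_complex]
  have e1 : (x : ℂ) ^ (a - 1) = (x : ℂ) ^ (a - 2) * x := by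
    rw [show a - 1 = a - 2 + 1 by ring, Complex.cpow_add _ _ hx', Complex.cpow_one]
  have e2 : (u.2.1 : ℂ) ^ (-(a - 1)) = (u.2.1 : ℂ) ^ (-a) * u.2.1 := by
    rw [show -(a - 1) = -a + 1 by ring, Complex.cpow_add _ _ hδ', Complex.cpow_one]
  have e3 : Complex.exp (-((hermDet u / u.2.1 : ℝ) * x)) = Complex.exp (-(u.1 * x)) *
      Complex.exp ((-2) ^ 2 * ‖u.2.2‖ ^ 2 / (4 * ((u.2.1 / x : ℝ) : ℂ))) := by
    rw [← Complex.exp_add]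
    congr 1
    rw [← Complex.ofReal_pow, ← Complex.normSq_eq_norm_sq, hermDet]
    push_cast
    field_simp
    ring
  rw [e1, e2, e3]
  norm_num
  field_simp

theorem hasIntegral_sheared {u : ℝ × ℝ × ℂ} (hu : u ∈ posDefTwo) {a : ℂ} (ha : 1 < a.re) :
    Integrable (shearedIntegrand u a) ∧
      ∫ v, shearedIntegrand u a v = complexMultivariateGamma 2 a * (hermDet u : ℂ) ^ (-a) := by
  have hδ := snd_pos_of_mem hu
  have hr : 0 < hermDet u / u.2.1 := div_pos ((mem_posDefTwo_iff u).1 hu).2 hδ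
  have hzero : ∀ (b : ℂ) (x : ℝ), ¬ 0 < x → (fun q => shearedIntegrand u b (x, q)) = 0 := by
    intro b x hx
    ext q
    simp [shearedIntegrand, hx]
  have hslice : ∀ b : ℂ, 1 < b.re → (fun x => ∫ q, shearedIntegrand u b (x, q)) =
      (Set.Ioi 0).indicator fun x : ℝ => 
        (Real.pi * (u.2.1 : ℂ) ^ (-b) * Complex.Gamma (b - 1)) *
          ((x : ℂ) ^ (b - 1) * Complex.exp (-((hermDet u / u.2.1 : ℝ) * x))) := by
    intro b hb
    ext x
    by_cases hx : 0 < x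
    · rw [Set.indicator_of_mem (Set.mem_Ioi.2 hx), (hasIntegral_sheared_slice hu hb hx).2]
    · rw [Set.indicator_of_notMem (by simpa using hx), hzero b x hx]
      simp
  have hint : Integrable (shearedIntegrand u a) := by
    rw [Measure.volume_eq_prod, integrable_prod_iff
      (measurable_shearedIntegrand u a).aestronglyMeasurable]
    refine ⟨Filter.Eventually.of_forall fun x => ?_, ?_⟩
    · by_cases hx : 0 < x
      · exact (hasIntegral_sheared_slice hu ha hx).1
      · rw [hzero a x hx]
        exact integrable_zero _ _ _
    · have : (fun x => ∫ q, ‖shearedIntegrand u a (x, q)‖) = fun x =>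
          (∫ q, shearedIntegrand u (a.re : ℂ) (x, q)).re := by
        ext x
        simp_rw [← norm_shearedIntegrand u a]
        rw [integral_complex_ofReal, Complex.ofReal_re]
      rw [this]
      have h : Integrable fun x => ∫ q, shearedIntegrand u (a.re : ℂ) (x, q) := by
        rw [hslice _ (by simpa using ha), integrable_indicator_iff measurableSet_Ioi]
        exact (hasIntegral_gamma (by simp; linarith) hr).1.const_mul _
      exact h.re
  refine ⟨hint, ?_⟩
  rw [Measure.volume_eq_prod, integral_prod _ (by rwa [← Measure.volume_eq_prod])]
  rw [hslice a ha, integral_indicator measurableSet_Ioi, integral_const_mul,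
    (hasIntegral_gamma (by linarith) hr).2]
  have e : (hermDet u : ℂ) ^ (-a) = ((hermDet u / u.2.1 : ℝ) : ℂ) ^ (-a) * (u.2.1 : ℂ) ^ (-a) := by
    rw [← Complex.mul_cpow_ofReal_nonneg hr.le hδ.le, ← Complex.ofReal_mul,
      div_mul_cancel₀ _ hδ.ne']
  have e' : complexMultivariateGamma 2 a =
      Real.pi * (Complex.Gamma a * Complex.Gamma (a - 1)) := by
    simp [complexMultivariateGamma, Finset.prod_Icc_succ_top]
    left; congr 1; ring
  rw [e, e']
  ring

theorem gammaIntegrand_integrableOn {u : ℝ × ℝ × ℂ} (hu : u ∈ posDefTwo) {a : ℂ} (ha : 1 < a.re) :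
    IntegrableOn (gammaIntegrand u a) posDefTwo := by
  rw [← integrable_indicator_iff isOpen_posDefTwo.measurableSet,
    indicator_gammaIntegrand]
  exact (measurePreserving_shear.integrable_comp
    (measurable_shearedIntegrand u a).aestronglyMeasurable).2 (hasIntegral_sheared hu ha).1

theorem integral_gammaIntegrand {u : ℝ × ℝ × ℂ} (hu : u ∈ posDefTwo) {a : ℂ} (ha : 1 < a.re) :
    ∫ v in posDefTwo, gammaIntegrand u a v =
      complexMultivariateGamma 2 a * (hermDet u : ℂ) ^ (-a) := by
  rw [← integral_indicator isOpen_posDefTwo.measurableSet, indicator_gammaIntegrand,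
    ← (hasIntegral_sheared hu ha).2]
  rw [← integral_map (f := shearedIntegrand u a) measurePreserving_shear.measurable.aemeasurable
    (measurable_shearedIntegrand u a).aestronglyMeasurable, measurePreserving_shear.map_eq]

/-! ### Moments as power series coefficients -/

theorem coeff_eq_of_hasSum {c d : ℕ → ℂ} {f : ℝ → ℂ}
    (hc : ∀ᶠ z : ℝ in nhds 0, HasSum (fun n => (z : ℂ) ^ n * c n) (f z))
    (hd : ∀ᶠ z : ℝ in nhds 0, HasSum (fun n => (z : ℂ) ^ n * d n) (f z)) : c = d := by
  have aux : ∀ e : ℕ → ℂ, (∀ᶠ z : ℝ in nhds 0, HasSum (fun n => (z : ℂ) ^ n * e n) (f z)) →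
      HasFPowerSeriesAt f
        ((fun n => ContinuousMultilinearMap.mkPiRing ℝ (Fin n) (e n) :
          FormalMultilinearSeries ℝ ℝ ℂ)) 0 := by
    intro e he
    refine hasFPowerSeriesAt_iff.2 ?_
    filter_upwards [he] with z hz
    simpa [FormalMultilinearSeries.coeff] using hz
  have h := (aux c hc).eq_formalMultilinearSeries (aux d hd)
  ext n
  have := congrFun h n
  simpa using congrArg (fun m => m fun _ => 1) this

/-- Since `(ε x)^n / n! ≤ exp(ε x)`, the moment integrand at `u` is dominated by a multiple of the
original integrand at `u - ε b`, still in the cone for small `ε`. As `u` is arbitrary in the cone,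
the conclusion supplies the hypothesis for the next moment, and the lemma can be iterated. -/
theorem moment_integrableOn {g : ℝ × ℝ × ℂ → ℂ} (hgm : Measurable g)
    (hg : ∀ u ∈ posDefTwo,
      IntegrableOn (fun v => Complex.exp (-(hermPairing u v : ℂ)) * g v) posDefTwo)
    {u b : ℝ × ℝ × ℂ} (hu : u ∈ posDefTwo) (hb : b ∈ posDefTwo) (n : ℕ) :
    IntegrableOn (fun v => Complex.exp (-(hermPairing u v : ℂ)) *
      ((hermPairing b v : ℂ) ^ n * g v)) posDefTwo := by
  obtain ⟨ε, hε, hε0⟩ := ((eventually_sub_smul_mem hu b).filter_mono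
    (nhdsWithin_le_nhds (s := Set.Ioi 0))).and self_mem_nhdsWithin |>.exists
  have hε0 : 0 < ε := hε0
  have hmu := measurable_hermPairing u
  have hmb := measurable_hermPairing b
  refine Integrable.mono' (((hg _ hε).norm).const_mul (n.factorial / ε ^ n)) ?_ ?_
  · fun_prop
  · filter_upwards [ae_restrict_mem isOpen_posDefTwo.measurableSet] with v hv
    have hp := hermPairing_pos hb hv
    have h := Real.pow_div_factorial_le_exp (ε * hermPairing b v) (by positivity) n
    rw [div_le_iff₀ (by positivity), mul_pow] at h
    simp only [norm_mul, Complex.norm_exp, norm_pow, Complex.norm_real, Complex.neg_re,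
      Complex.ofReal_re, hermPairing_sub_smul, Real.norm_of_nonneg hp.le]
    rw [neg_sub, sub_eq_add_neg, Real.exp_add]
    have h2 : hermPairing b v ^ n ≤ n.factorial / ε ^ n * Real.exp (ε * hermPairing b v) := by
      rw [div_mul_eq_mul_div, le_div_iff₀ (by positivity)]
      linarith
    calc _ ≤ Real.exp (-hermPairing u v) *
          (n.factorial / ε ^ n * Real.exp (ε * hermPairing b v) * ‖g v‖) := by gcongr
      _ = _ := by ring

/-- Expand `exp(z tr(bX))` and integrate termwise by dominated convergence. The absolute values of
the terms sum to the norm of the integrand at `u - |z| b`, which is why that point must lie in the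
cone. -/
theorem hasSum_moments {g : ℝ × ℝ × ℂ → ℂ} (hgm : Measurable g)
    (hg : ∀ u ∈ posDefTwo,
      IntegrableOn (fun v => Complex.exp (-(hermPairing u v : ℂ)) * g v) posDefTwo)
    {u b : ℝ × ℝ × ℂ} (hu : u ∈ posDefTwo) (hb : b ∈ posDefTwo) :
    ∀ᶠ z : ℝ in nhds 0, HasSum (fun n : ℕ => (z : ℂ) ^ n * ((n.factorial : ℂ)⁻¹ *
        ∫ v in posDefTwo, Complex.exp (-(hermPairing u v : ℂ)) *
          ((hermPairing b v : ℂ) ^ n * g v)))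
      (∫ v in posDefTwo, Complex.exp (-(hermPairing (u - z • b) v : ℂ)) * g v) := by
  have habs : Filter.Tendsto (fun z : ℝ => |z|) (nhds 0) (nhds 0) := by
    simpa using (continuous_abs (G := ℝ)).tendsto 0
  filter_upwards [habs.eventually (eventually_sub_smul_mem hu b)] with z hz
  have hmu := measurable_hermPairing u
  have hmb := measurable_hermPairing b
  have hexp : ∀ x : ℝ, HasSum (fun n : ℕ => x ^ n / n.factorial) (Real.exp x) := by
    intro x
    rw [Real.exp_eq_exp_ℝ]
    exact NormedSpace.expSeries_div_hasSum_exp x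
  have hsum : ∀ v, HasSum (fun n : ℕ => (|z| * hermPairing b v) ^ n / n.factorial *
      (Real.exp (-hermPairing u v) * ‖g v‖))
      (‖Complex.exp (-(hermPairing (u - |z| • b) v : ℂ)) * g v‖) := by
    intro v
    have := (hexp (|z| * hermPairing b v)).mul_right (Real.exp (-hermPairing u v) * ‖g v‖)
    convert! this using 1
    rw [norm_mul, Complex.norm_exp, Complex.neg_re, Complex.ofReal_re, hermPairing_sub_smul,
      ← mul_assoc, ← Real.exp_add]
    ring_nf
  have main := hasSum_integral_of_dominated_convergence (μ := volume.restrict posDefTwo)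
    (F := fun (n : ℕ) v => ((z : ℂ) ^ n * (n.factorial : ℂ)⁻¹) *
      (Complex.exp (-(hermPairing u v : ℂ)) * ((hermPairing b v : ℂ) ^ n * g v)))
    (f := fun v => Complex.exp (-(hermPairing (u - z • b) v : ℂ)) * g v)
    (fun (n : ℕ) v => (|z| * hermPairing b v) ^ n / n.factorial *
      (Real.exp (-hermPairing u v) * ‖g v‖)) ?_ ?_ ?_ ?_ ?_
  · simp_rw [integral_const_mul, mul_assoc] at main
    simpa only [mul_assoc] using main
  · intro n
    fun_prop
  · intro n
    filter_upwards [ae_restrict_mem isOpen_posDefTwo.measurableSet] with v hv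
    have hp := hermPairing_pos hb hv
    simp only [norm_mul, Complex.norm_exp, norm_pow, Complex.norm_real, Complex.neg_re,
      Complex.ofReal_re, Real.norm_of_nonneg hp.le, Real.norm_eq_abs, norm_inv,
      Complex.norm_natCast]
    apply le_of_eq
    rw [mul_pow]
    ring
  · exact Filter.Eventually.of_forall fun v => (hsum v).summable
  · simp_rw [fun v => (hsum v).tsum_eq]
    exact (hg _ hz).norm
  · refine Filter.Eventually.of_forall fun v => ?_
    have h1 : HasSum (fun n : ℕ => ((z : ℂ) * hermPairing b v) ^ n / n.factorial)
        (Complex.exp (z * hermPairing b v)) := by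
      rw [Complex.exp_eq_exp_ℂ]
      exact NormedSpace.expSeries_div_hasSum_exp _
    have h2 := h1.mul_right (Complex.exp (-(hermPairing u v : ℂ)) * g v)
    convert! h2 using 1
    · ext n
      rw [mul_pow]
      ring
    · rw [hermPairing_sub_smul, ← mul_assoc, ← Complex.exp_add]
      push_cast
      ring_nf

/-! ### Binomial series and Cauchy products -/

theorem pochhammer_succ (a : ℂ) (n : ℕ) : pochhammer a (n + 1) = pochhammer a n * (a + n) := by
  simp [pochhammer, Finset.prod_range_succ]

theorem pochhammer_eq_ascPochhammer_eval (a : ℂ) (n : ℕ) :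
    pochhammer a n = (ascPochhammer ℂ n).eval a := by
  induction n with
  | zero => simp [pochhammer]
  | succ n ih => rw [pochhammer_succ, ascPochhammer_succ_eval, ih]

theorem ring_choose_eq_pochhammer_div (a : ℂ) (n : ℕ) :
    Ring.choose (a + n - 1) n = pochhammer a n / (n.factorial : ℂ) := by
  rw [← Ring.multichoose_eq, eq_div_iff (by exact_mod_cast n.factorial_ne_zero),
    pochhammer_eq_ascPochhammer_eval, mul_comm, ← nsmul_eq_mul,
    Ring.factorial_nsmul_multichoose_eq_ascPochhammer, Polynomial.ascPochhammer_smeval_eq_eval]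

theorem hasSum_one_sub_cpow_neg (ν : ℂ) {u : ℂ} (hu : ‖u‖ < 1) :
    HasSum (fun n : ℕ => pochhammer ν n / (n.factorial : ℂ) * u ^ n) ((1 - u) ^ (-ν)) := by
  have h := (Complex.one_div_one_sub_cpow_hasFPowerSeriesOnBall_zero ν).hasSum (y := u) (by
    simpa [Metric.mem_eball, edist_zero_right, enorm_eq_nnnorm] using
      (by exact_mod_cast hu : ‖u‖₊ < 1))
  simp only [zero_add] at h
  rw [Complex.cpow_neg, ← one_div]
  convert! h using 2 with n
  simp [FormalMultilinearSeries.ofScalars, ring_choose_eq_pochhammer_div]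

theorem hasSum_cauchy_product {c d : ℕ → ℂ} {z f g : ℂ}
    (hc : HasSum (fun n => z ^ n * c n) f) (hd : HasSum (fun n => z ^ n * d n) g) :
    HasSum (fun n => z ^ n * ∑ k ∈ Finset.range (n + 1), c k * d (n - k)) (f * g) := by
  have h := hasSum_sum_range_mul_of_summable_norm hc.summable.norm hd.summable.norm
  rw [hc.tsum_eq, hd.tsum_eq] at h
  convert! h using 2 with n
  rw [Finset.mul_sum]
  refine Finset.sum_congr rfl fun k hk => ?_
  have : n = k + (n - k) := by have := Finset.mem_range.1 hk; omega
  conv_lhs => rw [this, pow_add]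
  simp only [add_tsub_cancel_left]
  ring

theorem hasSum_sub_mul_pow (α β z : ℂ) (m : ℕ) :
    HasSum (fun n : ℕ => z ^ n * ((m.choose n : ℂ) * α ^ (m - n) * (-β) ^ n))
      ((α - z * β) ^ m) := by
  have : (α - z * β) ^ m = ∑ n ∈ Finset.range (m + 1),
      z ^ n * ((m.choose n : ℂ) * α ^ (m - n) * (-β) ^ n) := by
    rw [sub_eq_neg_add, add_pow]
    refine Finset.sum_congr rfl fun k _ => ?_
    rw [show -(z * β) = z * (-β) by ring, mul_pow]
    ring
  rw [this]
  refine hasSum_sum_of_ne_finset_zero fun n hn => ?_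
  rw [Nat.choose_eq_zero_of_lt (by simpa using hn)]
  simp

theorem hasSum_one_sub_mul_cpow_mul (ν : ℂ) {α β z : ℂ} (hα : ‖α * z‖ < 1) (hβ : ‖β * z‖ < 1) :
    HasSum (fun n : ℕ => z ^ n * ∑ k ∈ Finset.range (n + 1),
        (pochhammer ν k / (k.factorial : ℂ) * α ^ k) *
          (pochhammer ν (n - k) / ((n - k).factorial : ℂ) * β ^ (n - k)))
      ((1 - α * z) ^ (-ν) * (1 - β * z) ^ (-ν)) := by
  have aux : ∀ γ : ℂ, ‖γ * z‖ < 1 → HasSum (fun n : ℕ => z ^ n *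
      (pochhammer ν n / (n.factorial : ℂ) * γ ^ n)) ((1 - γ * z) ^ (-ν)) := by
    intro γ hγ
    convert! hasSum_one_sub_cpow_neg ν hγ using 2 with n
    rw [mul_pow]
    ring
  have h := hasSum_cauchy_product (c := fun n => pochhammer ν n / (n.factorial : ℂ) * α ^ n)
    (d := fun n => pochhammer ν n / (n.factorial : ℂ) * β ^ n) (aux α hα) (aux β hβ)
  exact h

/-! ### The Gegenbauer generating function -/

noncomputable section

/-- The homogeneous form of the Gegenbauer polynomial, the coefficient of `zⁿ` in
`(1 - b z + d z²) ^ (-ν)`. -/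
def gegenbauerForm (n : ℕ) (ν b d : ℂ) : ℂ :=
  ∑ k ∈ Finset.range (n / 2 + 1),
    (-1) ^ k * pochhammer ν (n - k) / ((k.factorial : ℂ) * ((n - 2 * k).factorial : ℂ)) *
      (b ^ (n - 2 * k) * d ^ k)

/-- The terms of the expansion of `(1 - b z + d z²) ^ (-ν)` in monomials of `b` and `d`. -/
def gegenbauerTerm (ν b d z : ℂ) (q : ℕ × ℕ) : ℂ :=
  pochhammer ν q.1 / (q.1.factorial : ℂ) *
    ((z * (-(d * z))) ^ q.2 * (z * b) ^ (q.1 - q.2) * (q.1.choose q.2 : ℂ))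

end

/-- The homogeneous form is polynomial in `d`; a square root of `d` appears only on passing to the
usual normalization. -/
theorem gegenbauerForm_sq {n : ℕ} {ν b s : ℂ} (hs : s ≠ 0) :
    gegenbauerForm n ν b (s ^ 2) = s ^ n * gegenbauer n ν (b / (2 * s)) := by
  rw [gegenbauerForm, gegenbauer, Finset.mul_sum]
  refine Finset.sum_congr rfl fun k hk => ?_
  have h : n = 2 * k + (n - 2 * k) := by have := Finset.mem_range.1 hk; omega
  have e : s ^ n * (2 * (b / (2 * s))) ^ (n - 2 * k) = b ^ (n - 2 * k) * (s ^ 2) ^ k := by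
    conv_lhs => rw [show s ^ n = s ^ (2 * k + (n - 2 * k)) by rw [← h]]
    rw [pow_add, pow_mul, mul_assoc, ← mul_pow]
    field_simp
  rw [← e]
  ring

theorem hasSum_gegenbauerTerm_snd (ν b d z : ℂ) (m : ℕ) :
    HasSum (fun j => gegenbauerTerm ν b d z (m, j))
      (pochhammer ν m / (m.factorial : ℂ) * (b * z - d * z ^ 2) ^ m) := by
  have : pochhammer ν m / (m.factorial : ℂ) * (b * z - d * z ^ 2) ^ m =
      ∑ j ∈ Finset.range (m + 1), gegenbauerTerm ν b d z (m, j) := by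
    rw [show b * z - d * z ^ 2 = z * (-(d * z)) + z * b by ring, add_pow, Finset.mul_sum]
    rfl
  rw [this]
  refine hasSum_sum_of_ne_finset_zero fun n hn => ?_
  simp only [gegenbauerTerm]
  rw [Nat.choose_eq_zero_of_lt (by simpa using hn)]
  simp

theorem norm_gegenbauerTerm (ν b d z : ℂ) (q : ℕ × ℕ) :
    ‖gegenbauerTerm ν b d z q‖ = ‖pochhammer ν q.1 / (q.1.factorial : ℂ)‖ *
      ((‖z‖ ^ 2 * ‖d‖) ^ q.2 * (‖z‖ * ‖b‖) ^ (q.1 - q.2) * (q.1.choose q.2 : ℝ)) := by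
  simp only [gegenbauerTerm, norm_mul, norm_pow, norm_neg, Complex.norm_natCast]
  ring

/-- For fixed `m` the norms sum, by the binomial theorem, to the `m`-th term in norm of the binomial
series at the real number `‖z‖ * ‖b‖ + ‖z‖ ^ 2 * ‖d‖`. -/
theorem summable_gegenbauerTerm (ν : ℂ) {b d z : ℂ} (h : ‖z‖ * ‖b‖ + ‖z‖ ^ 2 * ‖d‖ < 1) :
    Summable (gegenbauerTerm ν b d z) := by
  have hs : ∀ m : ℕ, HasSum (fun j => ‖gegenbauerTerm ν b d z (m, j)‖)
      (‖pochhammer ν m / (m.factorial : ℂ)‖ * (‖z‖ * ‖b‖ + ‖z‖ ^ 2 * ‖d‖) ^ m) := by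
    intro m
    have : ‖pochhammer ν m / (m.factorial : ℂ)‖ * (‖z‖ * ‖b‖ + ‖z‖ ^ 2 * ‖d‖) ^ m =
        ∑ j ∈ Finset.range (m + 1), ‖gegenbauerTerm ν b d z (m, j)‖ := by
      rw [add_comm, add_pow, Finset.mul_sum]
      simp only [norm_gegenbauerTerm]
    rw [this]
    refine hasSum_sum_of_ne_finset_zero fun n hn => ?_
    rw [norm_gegenbauerTerm]
    simp only
    rw [Nat.choose_eq_zero_of_lt (by simpa using hn)]
    simp
  refine Summable.of_norm ?_
  rw [summable_prod_of_nonneg fun _ => norm_nonneg _]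
  refine ⟨fun m => (hs m).summable, ?_⟩
  simp_rw [fun m => (hs m).tsum_eq]
  have h0 : 0 ≤ ‖z‖ * ‖b‖ + ‖z‖ ^ 2 * ‖d‖ := by positivity
  have := (hasSum_one_sub_cpow_neg ν (u := ((‖z‖ * ‖b‖ + ‖z‖ ^ 2 * ‖d‖ : ℝ) : ℂ)) (by
    rwa [Complex.norm_real, Real.norm_of_nonneg h0])).summable.norm
  refine this.congr fun m => ?_
  rw [norm_mul, norm_pow, Complex.norm_real, Real.norm_of_nonneg h0]

/-- The term `(m, j)` has degree `2 j + (m - j) = m + j` in `z`, so antidiagonals collect equal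
powers. With `m = n - k` and `j = k`, terms with `k > n / 2` vanish because `(n - k).choose k = 0`.
-/
theorem sum_antidiagonal_gegenbauerTerm (ν b d z : ℂ) (n : ℕ) :
    ∑ q ∈ Finset.HasAntidiagonal.antidiagonal n, gegenbauerTerm ν b d z q = z ^ n * gegenbauerForm n ν b d := by
  rw [← Finset.Nat.sum_antidiagonal_swap, Finset.Nat.sum_antidiagonal_eq_sum_range_succ_mk,
    gegenbauerForm, Finset.mul_sum]
  symm
  refine Eq.trans (Finset.sum_congr rfl fun k hk => ?_)
    (Finset.sum_subset (s₁ := Finset.range (n / 2 + 1))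
      (f := fun k => gegenbauerTerm ν b d z (k, n - k).swap) ?_ ?_)
  · have hk : 2 * k ≤ n := by have := Finset.mem_range.1 hk; omega
    obtain ⟨r, rfl⟩ := Nat.exists_eq_add_of_le hk
    simp only [gegenbauerTerm, Prod.swap_prod_mk]
    have e1 : 2 * k + r - k = k + r := by omega
    have e2 : 2 * k + r - 2 * k = r := by omega
    rw [e1, e2, Nat.add_sub_cancel_left, Nat.cast_choose ℂ (Nat.le_add_right k r),
      Nat.add_sub_cancel_left]
    have h1 : ((k + r).factorial : ℂ) ≠ 0 := by exact_mod_cast Nat.factorial_ne_zero _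
    have h2 : (k.factorial : ℂ) ≠ 0 := by exact_mod_cast Nat.factorial_ne_zero _
    have h3 : (r.factorial : ℂ) ≠ 0 := by exact_mod_cast Nat.factorial_ne_zero _
    field_simp
    ring
  · intro k hk
    have := Finset.mem_range.1 hk
    rw [Finset.mem_range]
    omega
  · intro k hk hk'
    have h1 := Finset.mem_range.1 hk
    have h2 : ¬ k < n / 2 + 1 := by simpa using hk'
    simp only [gegenbauerTerm, Prod.swap_prod_mk]
    rw [Nat.choose_eq_zero_of_lt (by omega)]
    simp

/-- The same absolutely convergent double series is summed along rows, giving the binomial series,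
and along antidiagonals. -/
theorem hasSum_gegenbauerForm (ν : ℂ) {b d z : ℂ} (h : ‖z‖ * ‖b‖ + ‖z‖ ^ 2 * ‖d‖ < 1) :
    HasSum (fun n => z ^ n * gegenbauerForm n ν b d) ((1 - (b * z - d * z ^ 2)) ^ (-ν)) := by
  have hs := (summable_gegenbauerTerm ν h).hasSum
  have h1 := hs.prod_fiberwise (hasSum_gegenbauerTerm_snd ν b d z)
  have hu : ‖b * z - d * z ^ 2‖ < 1 := by
    refine lt_of_le_of_lt (norm_sub_le _ _) ?_
    rw [norm_mul, norm_mul, norm_pow]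
    linarith
  rw [h1.unique (hasSum_one_sub_cpow_neg ν hu)] at hs
  have h2 := (Finset.HasAntidiagonal.sigmaAntidiagonalEquivProd (A := ℕ)).hasSum_iff.2 hs
  refine (h2.sigma (g := fun n => z ^ n * gegenbauerForm n ν b d) fun n => ?_)
  rw [← sum_antidiagonal_gegenbauerTerm, ← Finset.sum_coe_sort]
  exact hasSum_fintype _

/-! ### Complete homogeneous sums and Chebyshev roots -/

/-- Homogeneous form of the Chebyshev polynomials of the second kind. -/
theorem sum_pow_mul_pow_eq_eval_U {α β s : ℝ} (hs : s ≠ 0) (h : s ^ 2 = α * β) (n : ℕ) :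
    ∑ j ∈ Finset.range (n + 1), α ^ j * β ^ (n - j) =
      s ^ n * (Polynomial.Chebyshev.U ℝ n).eval ((α + β) / (2 * s)) := by
  -- This is the recurrence `U (n + 2) = 2 x U (n + 1) - U n` at `x = (α + β) / (2 s)`, scaled by
  -- powers of `s`.
  have hrec : ∀ n : ℕ, ∑ j ∈ Finset.range (n + 2 + 1), α ^ j * β ^ (n + 2 - j) =
      (α + β) * ∑ j ∈ Finset.range (n + 1 + 1), α ^ j * β ^ (n + 1 - j) -
        α * β * ∑ j ∈ Finset.range (n + 1), α ^ j * β ^ (n - j) := by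
    have hb : ∀ n : ℕ, ∑ j ∈ Finset.range (n + 1 + 1), α ^ j * β ^ (n + 1 - j) =
        β * ∑ j ∈ Finset.range (n + 1), α ^ j * β ^ (n - j) + α ^ (n + 1) := by
      intro n
      rw [Finset.sum_range_succ, Finset.mul_sum]
      congr 1
      · refine Finset.sum_congr rfl fun j hj => ?_
        have : n + 1 - j = (n - j) + 1 := by have := Finset.mem_range.1 hj; omega
        rw [this, pow_succ]
        ring
      · simp
    intro n
    rw [hb (n + 1), hb n]
    ring
  induction n using Nat.twoStepInduction with
  | zero => simp
  | one =>
    simp [Finset.sum_range_succ]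
    field_simp
    ring
  | more n ih1 ih2 =>
    rw [hrec, ih1, ih2, ← h]
    push_cast
    rw [Polynomial.Chebyshev.U_add_two]
    simp only [Polynomial.eval_sub, Polynomial.eval_mul, Polynomial.eval_X, Polynomial.eval_ofNat]
    field_simp
    ring

theorem eval_U_eq_prod (n : ℕ) (x : ℝ) :
    (Polynomial.Chebyshev.U ℝ n).eval x =
      2 ^ n * ∏ k ∈ Finset.range n, (x - Real.cos ((k + 1) * Real.pi / (n + 1))) := by
  have hinj := (Finset.range n).nodup_map_iff_injOn.mp (Polynomial.Chebyshev.roots_U_real_nodup n)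
  have hcard : Multiset.card (Polynomial.Chebyshev.U ℝ n).roots =
      (Polynomial.Chebyshev.U ℝ n).natDegree := by
    rw [Polynomial.Chebyshev.roots_U_real, Polynomial.Chebyshev.natDegree_U_natCast,
      Finset.card_val, Finset.card_image_of_injOn hinj, Finset.card_range]
  have h := Polynomial.C_leadingCoeff_mul_prod_multiset_X_sub_C hcard
  rw [← h, Polynomial.Chebyshev.leadingCoeff_U_natCast, Polynomial.Chebyshev.roots_U_real,
    Finset.image_val_of_injOn hinj, Polynomial.eval_mul, Polynomial.eval_C,
    Polynomial.eval_multiset_prod, Multiset.map_map, Multiset.map_map]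
  simp [Finset.prod]

/-- The roots at angles `θ` and `π - θ` are opposite and pair into a difference of squares. For odd
`n` the middle root is `cos (π / 2) = 0` and leaves a factor `b`. -/
theorem prod_sub_cos_eq (n : ℕ) (b s : ℝ) :
    ∏ k ∈ Finset.range n, (b - 2 * s * Real.cos ((k + 1) * Real.pi / (n + 1))) =
      b ^ (n % 2) * ∏ k ∈ Finset.range (n / 2),
        (b ^ 2 - 4 * s ^ 2 * Real.cos ((k + 1) * Real.pi / (n + 1)) ^ 2) := by
  set f : ℕ → ℝ := fun k => b - 2 * s * Real.cos ((k + 1) * Real.pi / (n + 1)) with hf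
  have hn : n = n / 2 + n % 2 + n / 2 := by omega
  have hn1 : (n : ℝ) + 1 ≠ 0 := by positivity
  have hrefl : ∀ k < n / 2, f (n / 2 + n % 2 + (n / 2 - 1 - k)) =
      b + 2 * s * Real.cos ((k + 1) * Real.pi / (n + 1)) := by
    intro k hk
    have e : n / 2 + n % 2 + (n / 2 - 1 - k) = n - 1 - k := by omega
    have e2 : ((n - 1 - k : ℕ) : ℝ) = n - 1 - k := by
      rw [Nat.cast_sub (by omega), Nat.cast_sub (by omega)]
      simp
    simp only [hf]
    rw [e, e2, show ((n : ℝ) - 1 - k + 1) * Real.pi / (n + 1) =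
      Real.pi - (k + 1) * Real.pi / (n + 1) by field_simp; ring, Real.cos_pi_sub]
    ring
  have hmid : ∏ k ∈ Finset.range (n % 2), f (n / 2 + k) = b ^ (n % 2) := by
    rcases Nat.mod_two_eq_zero_or_one n with h | h
    · simp [h]
    · rw [h, Finset.prod_range_one, pow_one]
      simp only [hf, add_zero]
      have e : (n : ℝ) = 2 * (n / 2 : ℕ) + 1 := by
        exact_mod_cast (by omega : n = 2 * (n / 2) + 1)
      have hp : (((n / 2 : ℕ) : ℝ) + 1) * Real.pi / (n + 1) = Real.pi / 2 := by
        rw [div_eq_div_iff hn1 two_ne_zero, e]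
        ring
      rw [hp, Real.cos_pi_div_two]
      ring
  calc ∏ k ∈ Finset.range n, f k
      = ∏ k ∈ Finset.range (n / 2 + n % 2 + n / 2), f k := by rw [← hn]
    _ = b ^ (n % 2) * ∏ k ∈ Finset.range (n / 2), (f k * f (n / 2 + n % 2 + (n / 2 - 1 - k))) := by
      rw [Finset.prod_range_add, Finset.prod_range_add, hmid, Finset.prod_mul_distrib,
        Finset.prod_range_reflect (fun k => f (n / 2 + n % 2 + k))]
      ring
    _ = _ := by
      congr 1
      refine Finset.prod_congr rfl fun k hk => ?_
      rw [hrefl k (Finset.mem_range.1 hk)]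
      simp only [hf]
      ring

/-- Vieta's formula evaluated at `y / d`, with denominators cleared by `d ^ card s`. -/
theorem prod_sub_mul_eq_sum_esymm (s : Multiset ℝ) {y d : ℝ} (hd : d ≠ 0) :
    (s.map fun r => y - d * r).prod =
      ∑ i ∈ Finset.range (Multiset.card s + 1),
        (-1) ^ i * d ^ i * s.esymm i * y ^ (Multiset.card s - i) := by
  have h := congrArg (Polynomial.eval (y / d)) s.prod_X_sub_X_eq_sum_esymm
  rw [Polynomial.eval_multiset_prod, Multiset.map_map, Polynomial.eval_finsetSum] at h
  have h1 : (s.map fun r => y - d * r).prod =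
      d ^ Multiset.card s * (s.map fun r => y / d - r).prod := by
    have h2 : (s.map fun r => d * (y / d - r)).prod =
        d ^ Multiset.card s * (s.map fun r => y / d - r).prod := by
      simp [Multiset.prod_map_mul]
    rw [← h2]
    congr 1
    refine Multiset.map_congr rfl fun r _ => ?_
    field_simp
  rw [h1]
  simp only [Function.comp_def, Polynomial.eval_sub, Polynomial.eval_X, Polynomial.eval_C,
    Polynomial.eval_mul, Polynomial.eval_pow, Polynomial.eval_neg, Polynomial.eval_one] at h
  rw [h, Finset.mul_sum]
  refine Finset.sum_congr rfl fun i hi => ?_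
  have : Multiset.card s = i + (Multiset.card s - i) := by
    have := Finset.mem_range.1 hi; omega
  conv_lhs => rw [this]
  rw [Nat.add_sub_cancel_left, pow_add, div_pow]
  field_simp

/-- With `n = 2 t₁ - t`, the ceiling of `(n - 1) / 2` is the floor of `n / 2`; at `n = 0` the
ceiling of `-1 / 2` is `0`. -/
theorem ceilBound_eq {t t₁ : ℕ} (h : t ≤ 2 * t₁) : ceilBound t t₁ = (2 * t₁ - t) / 2 := by
  obtain ⟨n, hn⟩ := Nat.exists_eq_add_of_le h
  have e : 2 * (t₁ : ℝ) - t = n := by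
    have : ((2 * t₁ : ℕ) : ℝ) = ((t + n : ℕ) : ℝ) := by rw [hn]
    push_cast at this
    linarith
  rw [ceilBound, e, show 2 * t₁ - t = n by omega]
  apply le_antisymm
  · rw [Nat.ceil_le]
    have : (n : ℝ) ≤ 2 * (n / 2 : ℕ) + 1 := by
      exact_mod_cast (by omega : n ≤ 2 * (n / 2) + 1)
    linarith
  · by_contra! hlt
    have h1 : ⌈((n : ℝ) - 1) / 2⌉₊ ≤ n / 2 - 1 := by omega
    rw [Nat.ceil_le] at h1
    have h2 : ((n / 2 - 1 : ℕ) : ℝ) = (n / 2 : ℕ) - 1 := by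
      rw [Nat.cast_sub (by omega)]
      simp
    have h3 : (2 * (n / 2 : ℕ) : ℝ) ≤ n := by exact_mod_cast (by omega : 2 * (n / 2) ≤ n)
    rw [h2] at h1
    linarith

theorem sum_pow_mul_pow_eq_sum_cosEsymm {α β : ℝ} (hα : 0 < α) (hβ : 0 < β) {t t₁ : ℕ}
    (h : t ≤ 2 * t₁) :
    ∑ j ∈ Finset.range (2 * t₁ - t + 1), α ^ j * β ^ (2 * t₁ - t - j) =
      ∑ i ∈ Finset.range (ceilBound t t₁ + 1), (-1) ^ i * 4 ^ i * cosEsymm t t₁ i *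
        (α + β) ^ (2 * t₁ - t - 2 * i) * (α * β) ^ i := by
  have hd : 0 < α * β := mul_pos hα hβ
  have hs : Real.sqrt (α * β) ≠ 0 := (Real.sqrt_pos.2 hd).ne'
  have hc := ceilBound_eq h
  have e : 2 * (t₁ : ℝ) - t = (2 * t₁ - t : ℕ) := by
    rw [Nat.cast_sub h]
    simp
  unfold cosEsymm
  rw [hc, e]
  generalize 2 * t₁ - t = n
  rw [sum_pow_mul_pow_eq_eval_U hs (Real.sq_sqrt hd.le), eval_U_eq_prod, ← mul_assoc, ← mul_pow,
    ← Finset.card_range n, ← Finset.prod_const, Finset.card_range, ← Finset.prod_mul_distrib]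
  have h1 : ∀ k : ℕ, Real.sqrt (α * β) * 2 *
      ((α + β) / (2 * Real.sqrt (α * β)) - Real.cos ((k + 1) * Real.pi / (n + 1))) =
      (α + β) - 2 * Real.sqrt (α * β) * Real.cos ((k + 1) * Real.pi / (n + 1)) := by
    intro k
    field_simp
  simp_rw [h1]
  rw [prod_sub_cos_eq, Real.sq_sqrt hd.le]
  have h2 : ∏ k ∈ Finset.range (n / 2),
        ((α + β) ^ 2 - 4 * (α * β) * Real.cos ((k + 1) * Real.pi / (n + 1)) ^ 2) =
      (((Finset.Icc 1 (n / 2)).val.map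
        (fun j : ℕ => Real.cos (j * Real.pi / (n + 1)) ^ 2)).map
          fun r => (α + β) ^ 2 - 4 * (α * β) * r).prod := by
    rw [Multiset.map_map]
    change _ = ∏ j ∈ Finset.Icc 1 (n / 2), _
    rw [← Finset.Ico_succ_right_eq_Icc, Finset.prod_Ico_eq_prod_range]
    refine Finset.prod_congr (by simp) fun k _ => ?_
    simp [add_comm]
  rw [h2, prod_sub_mul_eq_sum_esymm _ (by positivity), Finset.mul_sum]
  simp only [Multiset.card_map, Finset.card_val, Nat.card_Icc, Nat.add_sub_cancel]
  refine Finset.sum_congr rfl fun i hi => ?_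
  have hi := Finset.mem_range.1 hi
  -- The factor from the middle root restores the parity of the exponent of `α + β`.
  rw [show n - 2 * i = n % 2 + 2 * (n / 2 - i) by omega, pow_add, pow_mul, mul_pow]
  ring

/-! ### Schur expansion of the coefficients -/

/-- With `c k = (a)_k / k!`, the `s`-th summand is `c s * c (t - s) - c (s - 1) * c (t - s + 1)` for
`s ≥ 1`, so the sum telescopes. -/
theorem sum_range_connection (a : ℂ) {t m : ℕ} (hm : 2 * m ≤ t) :
    ∑ s ∈ Finset.range (m + 1), pochhammer a (t - s) * pochhammer (a - 1) s *
        ((t : ℂ) - 2 * s + 1) / (((t - s + 1).factorial : ℂ) * (s.factorial : ℂ)) =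
      pochhammer a m / (m.factorial : ℂ) *
        (pochhammer a (t - m) / ((t - m).factorial : ℂ)) := by
  have hp : ∀ n, pochhammer (a - 1) (n + 1) = (a - 1) * pochhammer a n := by
    intro n
    rw [pochhammer, Finset.prod_range_succ', mul_comm]
    congr 1
    · simp
    · refine Finset.prod_congr rfl fun j _ => ?_
      push_cast
      ring
  induction m with
  | zero =>
    have h1 : (t.factorial : ℂ) ≠ 0 := by exact_mod_cast Nat.factorial_ne_zero _
    have h2 : (t : ℂ) + 1 ≠ 0 := by exact_mod_cast Nat.succ_ne_zero t
    simp [pochhammer, Nat.factorial_succ]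
    field_simp
  | succ m ih =>
    rw [Finset.sum_range_succ, ih (by omega)]
    obtain ⟨r, rfl⟩ := Nat.exists_eq_add_of_le hm
    have e1 : 2 * (m + 1) + r - m = (m + 1 + r) + 1 := by omega
    have e2 : 2 * (m + 1) + r - (m + 1) = m + 1 + r := by omega
    rw [e1, e2, hp, pochhammer_succ a m, pochhammer_succ a (m + 1 + r),
      Nat.factorial_succ (m + 1 + r), Nat.factorial_succ m]
    have h1 : (m.factorial : ℂ) ≠ 0 := by exact_mod_cast Nat.factorial_ne_zero _
    have h2 : ((m + 1 + r).factorial : ℂ) ≠ 0 := by exact_mod_cast Nat.factorial_ne_zero _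
    have h3 : (m : ℂ) + 1 ≠ 0 := by exact_mod_cast Nat.succ_ne_zero m
    have h4 : (m : ℂ) + 1 + r + 1 ≠ 0 := by exact_mod_cast Nat.succ_ne_zero (m + 1 + r)
    push_cast
    field_simp
    ring

/-- The monomial `α^k β^(t-k)` occurs in the `s`-th Schur polynomial exactly when `s ≤ min k (t -
k)`. After exchanging the sums, its coefficient is the telescoping sum of `sum_range_connection`. -/
theorem sum_pochhammer_mul_pochhammer (a α β : ℂ) (t : ℕ) :
    ∑ k ∈ Finset.range (t + 1), (pochhammer a k / (k.factorial : ℂ) * α ^ k) *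
        (pochhammer a (t - k) / ((t - k).factorial : ℂ) * β ^ (t - k)) =
      ∑ s ∈ Finset.range (t / 2 + 1), pochhammer a (t - s) * pochhammer (a - 1) s *
        ((t : ℂ) - 2 * s + 1) / (((t - s + 1).factorial : ℂ) * (s.factorial : ℂ)) *
        ((α * β) ^ s * ∑ j ∈ Finset.range (t - 2 * s + 1), α ^ j * β ^ (t - 2 * s - j)) := by
  have h1 : ∀ s ∈ Finset.range (t / 2 + 1),
      (α * β) ^ s * ∑ j ∈ Finset.range (t - 2 * s + 1), α ^ j * β ^ (t - 2 * s - j) =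
        ∑ k ∈ Finset.Ico s (t - s + 1), α ^ k * β ^ (t - k) := by
    intro s hs
    have hs := Finset.mem_range.1 hs
    rw [Finset.sum_Ico_eq_sum_range, Finset.mul_sum]
    refine Finset.sum_congr (by congr 1; omega) fun j hj => ?_
    have hj := Finset.mem_range.1 hj
    rw [show t - (s + j) = s + (t - 2 * s - j) by omega, pow_add, pow_add, mul_pow]
    ring
  symm
  refine (Finset.sum_congr rfl fun s hs => by rw [h1 s hs, Finset.mul_sum]).trans ?_
  rw [Finset.sum_comm' (t' := Finset.range (t + 1))
    (s' := fun k => Finset.range (min k (t - k) + 1))]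
  · refine Finset.sum_congr rfl fun k hk => ?_
    have hk := Finset.mem_range.1 hk
    rw [← Finset.sum_mul, sum_range_connection a (by omega)]
    rcases le_total k (t - k) with h | h
    · rw [min_eq_left h]
      ring
    · rw [min_eq_right h, show t - (t - k) = k by omega]
      ring
  · intro s k
    simp only [Finset.mem_range, Finset.mem_Ico]
    omega

theorem sum_pochhammer_mul_pochhammer_eq (a : ℂ) {α β : ℝ} (hα : 0 < α) (hβ : 0 < β) (t : ℕ) :
    ∑ k ∈ Finset.range (t + 1), (pochhammer a k / (k.factorial : ℂ) * (α : ℂ) ^ k) *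
        (pochhammer a (t - k) / ((t - k).factorial : ℂ) * (β : ℂ) ^ (t - k)) =
      ∑ t₁ ∈ Finset.Icc ⌈(t : ℝ) / 2⌉₊ t,
        pochhammer a t₁ * pochhammer (a - 1) (t - t₁) * (2 * (t₁ : ℂ) + 1 - t) /
          (((t₁ + 1).factorial : ℂ) * ((t - t₁).factorial : ℂ)) *
        ∑ i ∈ Finset.range (ceilBound t t₁ + 1), (-1) ^ i * 4 ^ i * (cosEsymm t t₁ i : ℂ) *
          ((α + β : ℝ) : ℂ) ^ (2 * t₁ - t - 2 * i) * ((α * β : ℝ) : ℂ) ^ (t - t₁ + i) := by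
  have hmem : ∀ t₁, t₁ ∈ Finset.Icc ⌈(t : ℝ) / 2⌉₊ t ↔ t ≤ 2 * t₁ ∧ t₁ ≤ t := by
    intro t₁
    rw [Finset.mem_Icc, Nat.ceil_le, div_le_iff₀ two_pos, mul_comm]
    norm_cast
  rw [sum_pochhammer_mul_pochhammer]
  refine Finset.sum_nbij' (fun s => t - s) (fun t₁ => t - t₁) ?_ ?_ ?_ ?_ ?_
  · intro s hs
    have hs := Finset.mem_range.1 hs
    rw [hmem]
    omega
  · intro t₁ ht
    rw [hmem] at ht
    rw [Finset.mem_range]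
    omega
  · intro s hs
    have hs := Finset.mem_range.1 hs
    omega
  · intro t₁ ht
    rw [hmem] at ht
    omega
  · intro s hs
    have hs := Finset.mem_range.1 hs
    have e1 : t - (t - s) = s := by omega
    have e2 : t - 2 * s = 2 * (t - s) - t := by omega
    have e3 : 2 * ((t - s : ℕ) : ℂ) + 1 - t = t - 2 * s + 1 := by
      rw [Nat.cast_sub (by omega)]
      ring
    rw [e1, e2, e3]
    congr 1
    have h := congrArg (fun x : ℝ => (x : ℂ))
      (sum_pow_mul_pow_eq_sum_cosEsymm hα hβ (show t ≤ 2 * (t - s) by omega))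
    push_cast at h ⊢
    rw [h, Finset.mul_sum]
    refine Finset.sum_congr rfl fun i _ => ?_
    rw [pow_add]
    ring

/-! ### The two moment expansions -/

/-- `tr X` is the pairing with the identity matrix, so trace moments are an instance of the general
moments. -/
theorem trace_vec_mem : ((1, 1, 0) : ℝ × ℝ × ℂ) ∈ posDefTwo := by
  rw [mem_posDefTwo_iff]
  simp [hermDet]

theorem hermPairing_one (v : ℝ × ℝ × ℂ) : hermPairing (1, 1, 0) v = v.1 + v.2.1 := by
  simp [hermPairing]

/-- The polarization of `hermDet`. -/
def hermMixedDet (u b : ℝ × ℝ × ℂ) : ℝ :=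
  u.1 * b.2.1 + u.2.1 * b.1 - 2 * (u.2.2.re * b.2.2.re + u.2.2.im * b.2.2.im)

theorem hermDet_sub_smul (u b : ℝ × ℝ × ℂ) (z : ℝ) :
    hermDet (u - z • b) = hermDet u - z * hermMixedDet u b + z ^ 2 * hermDet b := by
  simp [hermDet, hermMixedDet, Complex.normSq_apply]
  ring

/-- The roots of the characteristic polynomial of the inverse matrix, real because the discriminant
is `(u.1 - u.2.1)² + 4 |u.2.2|²` up to a positive factor. -/
theorem exists_inv_eigenvalues {u : ℝ × ℝ × ℂ} (hu : u ∈ posDefTwo) :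
    ∃ α β : ℝ, 0 < α ∧ 0 < β ∧ α + β = (u.1 + u.2.1) / hermDet u ∧
      α * β = 1 / hermDet u := by
  obtain ⟨h1, hd⟩ := (mem_posDefTwo_iff u).1 hu
  have h2 := snd_pos_of_mem hu
  have hdisc : 0 ≤ (u.1 + u.2.1) ^ 2 - 4 * hermDet u := by
    have := Complex.normSq_nonneg u.2.2
    have : (u.1 + u.2.1) ^ 2 - 4 * hermDet u = (u.1 - u.2.1) ^ 2 + 4 * Complex.normSq u.2.2 := by
      unfold hermDet; ring
    rw [this]
    positivity
  set q := Real.sqrt ((u.1 + u.2.1) ^ 2 - 4 * hermDet u) with hq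
  have hq2 : q ^ 2 = (u.1 + u.2.1) ^ 2 - 4 * hermDet u := Real.sq_sqrt hdisc
  have hq0 : 0 ≤ q := Real.sqrt_nonneg _
  have hlt : q < u.1 + u.2.1 := by
    refine lt_of_pow_lt_pow_left₀ 2 (by positivity) ?_
    rw [hq2]
    linarith
  refine ⟨(u.1 + u.2.1 + q) / (2 * hermDet u), (u.1 + u.2.1 - q) / (2 * hermDet u),
    by positivity, div_pos (by linarith) (by positivity), ?_, ?_⟩
  · field_simp
    ring
  · rw [div_mul_div_comm, show (u.1 + u.2.1 + q) * (u.1 + u.2.1 - q) = 4 * hermDet u by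
      linear_combination -hq2]
    field_simp
    ring

theorem eventually_norm_lt_one (c : ℂ) : ∀ᶠ z : ℝ in nhds 0, ‖c * (z : ℂ)‖ < 1 := by
  have h : Continuous fun z : ℝ => ‖c * (z : ℂ)‖ := by fun_prop
  exact h.continuousAt.eventually_lt continuousAt_const (by simp)

theorem eventually_one_sub_pos (c : ℝ) : ∀ᶠ z : ℝ in nhds 0, 0 < 1 - c * z := by
  have h : Continuous fun z : ℝ => 1 - c * z := by fun_prop
  exact continuousAt_const.eventually_lt h.continuousAt (by simp)

theorem measurable_hermDet_cpow (s : ℂ) : Measurable fun v => (hermDet v : ℂ) ^ s :=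
  (Complex.measurable_ofReal.comp measurable_hermDet).pow_const s

theorem integral_trace_moment {u : ℝ × ℝ × ℂ} (hu : u ∈ posDefTwo) {a : ℂ} (ha : 1 < a.re)
    (t : ℕ) :
    ∫ v in posDefTwo, Complex.exp (-(hermPairing u v : ℂ)) *
        ((hermPairing (1, 1, 0) v : ℂ) ^ t * (hermDet v : ℂ) ^ (a - 2)) =
      (t.factorial : ℂ) * complexMultivariateGamma 2 a * ∑ t₁ ∈ Finset.Icc ⌈(t : ℝ) / 2⌉₊ t,
        pochhammer a t₁ * pochhammer (a - 1) (t - t₁) * (2 * (t₁ : ℂ) + 1 - t) /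
          (((t₁ + 1).factorial : ℂ) * ((t - t₁).factorial : ℂ)) *
        ∑ i ∈ Finset.range (ceilBound t t₁ + 1), ((-1) ^ i * 4 ^ i * (cosEsymm t t₁ i : ℂ)) *
          (((u.1 + u.2.1 : ℝ) : ℂ) ^ (2 * t₁ - t - 2 * i) *
            (hermDet u : ℂ) ^ (-((t₁ : ℂ) - i + a))) := by
  obtain ⟨α, β, hα, hβ, hadd, hmul⟩ := exists_inv_eigenvalues hu
  have hd := ((mem_posDefTwo_iff u).1 hu).2
  have hd' : (hermDet u : ℂ) ≠ 0 := by exact_mod_cast hd.ne'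
  have hmom := hasSum_moments (measurable_hermDet_cpow (a - 2))
    (fun u hu => gammaIntegrand_integrableOn hu ha) hu trace_vec_mem
  have hser : ∀ᶠ z : ℝ in nhds 0, HasSum (fun n => (z : ℂ) ^ n *
      ((complexMultivariateGamma 2 a * (hermDet u : ℂ) ^ (-a)) *
        ∑ k ∈ Finset.range (n + 1), (pochhammer a k / (k.factorial : ℂ) * (α : ℂ) ^ k) *
          (pochhammer a (n - k) / ((n - k).factorial : ℂ) * (β : ℂ) ^ (n - k))))
      (∫ v in posDefTwo, Complex.exp (-(hermPairing (u - z • (1, 1, 0)) v : ℂ)) *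
        (hermDet v : ℂ) ^ (a - 2)) := by
    filter_upwards [eventually_sub_smul_mem hu (1, 1, 0), eventually_norm_lt_one α,
      eventually_norm_lt_one β, eventually_one_sub_pos α, eventually_one_sub_pos β]
      with z hz h1 h2 h3 h4
    have hint := integral_gammaIntegrand hz ha
    unfold gammaIntegrand at hint
    have hdet : hermDet (u - z • (1, 1, 0)) = hermDet u * ((1 - α * z) * (1 - β * z)) := by
      have e : (1 - α * z) * (1 - β * z) = 1 - (α + β) * z + α * β * z ^ 2 := by ring
      rw [hermDet_sub_smul, e, hadd, hmul]
      simp only [hermMixedDet, hermDet]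
      have : u.1 * u.2.1 - Complex.normSq u.2.2 ≠ 0 := hd.ne'
      simp
      field_simp
    -- Every factor is a positive real for small `z`, so the complex power splits over the product.
    rw [hint, hdet, Complex.ofReal_mul, Complex.mul_cpow_ofReal_nonneg hd.le (by positivity),
      Complex.ofReal_mul, Complex.mul_cpow_ofReal_nonneg h3.le h4.le]
    have h := (hasSum_one_sub_mul_cpow_mul a h1 h2).mul_left
      (complexMultivariateGamma 2 a * (hermDet u : ℂ) ^ (-a))
    push_cast
    rw [← mul_assoc]
    convert! h using 2 with n
    ring
  have h := congrFun (coeff_eq_of_hasSum hmom hser) t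
  have hf : (t.factorial : ℂ) ≠ 0 := by exact_mod_cast Nat.factorial_ne_zero _
  rw [inv_mul_eq_iff_eq_mul₀ hf, sum_pochhammer_mul_pochhammer_eq a hα hβ, hadd, hmul] at h
  rw [h, mul_assoc, mul_assoc, Finset.mul_sum]
  congr 2
  refine Finset.sum_congr rfl fun t₁ ht₁ => ?_
  rw [mul_left_comm, Finset.mul_sum]
  congr 1
  refine Finset.sum_congr rfl fun i hi => ?_
  have ht : t ≤ 2 * t₁ ∧ t₁ ≤ t := by
    rw [Finset.mem_Icc, Nat.ceil_le, div_le_iff₀ two_pos, mul_comm] at ht₁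
    exact_mod_cast ht₁
  have hi := Finset.mem_range.1 hi
  rw [ceilBound_eq ht.1] at hi
  -- Trace and determinant of the inverse each carry a denominator `hermDet u`, in total `t₁ - i` of
  -- them.
  have e1 : 2 * t₁ - t - 2 * i + (t - t₁ + i) = t₁ - i := by omega
  have e2 : -((t₁ : ℂ) - i + a) = -a + -((t₁ - i : ℕ) : ℂ) := by
    rw [Nat.cast_sub (by omega)]
    ring
  rw [e2, Complex.cpow_add _ _ hd', Complex.cpow_neg _ ((t₁ - i : ℕ) : ℂ), Complex.cpow_natCast,
    ← e1]
  push_cast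
  rw [one_div, div_pow, div_eq_mul_inv, ← inv_pow, ← inv_pow, pow_add]
  ring

/-- `integral_trace_moment` holds throughout the cone, hence at `u - z • b`. There each trace power
is a polynomial in `z` and each determinant power a Gegenbauer series; their Cauchy product gives
the sum over `k`. -/
theorem integral_pairing_trace_moment {u b : ℝ × ℝ × ℂ} (hu : u ∈ posDefTwo)
    (hb : b ∈ posDefTwo) {a : ℂ} (ha : 1 < a.re) (p t : ℕ) :
    ∫ v in posDefTwo, Complex.exp (-(hermPairing u v : ℂ)) * ((hermPairing b v : ℂ) ^ p *
        ((hermPairing (1, 1, 0) v : ℂ) ^ t * (hermDet v : ℂ) ^ (a - 2))) =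
      (p.factorial : ℂ) * ((t.factorial : ℂ) * complexMultivariateGamma 2 a *
        ∑ t₁ ∈ Finset.Icc ⌈(t : ℝ) / 2⌉₊ t,
        pochhammer a t₁ * pochhammer (a - 1) (t - t₁) * (2 * (t₁ : ℂ) + 1 - t) /
          (((t₁ + 1).factorial : ℂ) * ((t - t₁).factorial : ℂ)) *
        ∑ i ∈ Finset.range (ceilBound t t₁ + 1), ((-1) ^ i * 4 ^ i * (cosEsymm t t₁ i : ℂ)) *
          ((hermDet u : ℂ) ^ (-((t₁ : ℂ) - i + a)) *
            ∑ k ∈ Finset.range (p + 1), (((2 * t₁ - t - 2 * i).choose k : ℂ) *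
              ((u.1 + u.2.1 : ℝ) : ℂ) ^ (2 * t₁ - t - 2 * i - k) *
                (-((b.1 + b.2.1 : ℝ) : ℂ)) ^ k) *
              gegenbauerForm (p - k) ((t₁ : ℂ) - i + a)
                ((hermMixedDet u b / hermDet u : ℝ) : ℂ) ((hermDet b / hermDet u : ℝ) : ℂ))) := by
  have hd := ((mem_posDefTwo_iff u).1 hu).2
  have hmom := hasSum_moments
    (g := fun v => (hermPairing (1, 1, 0) v : ℂ) ^ t * (hermDet v : ℂ) ^ (a - 2))
    (((Complex.measurable_ofReal.comp (measurable_hermPairing _)).pow_const t).mul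
      (measurable_hermDet_cpow (a - 2)))
    (fun u hu => moment_integrableOn (measurable_hermDet_cpow (a - 2))
      (fun u hu => gammaIntegrand_integrableOn hu ha) hu trace_vec_mem t) hu hb
  have hf : (p.factorial : ℂ) ≠ 0 := by exact_mod_cast Nat.factorial_ne_zero _
  rw [← inv_mul_eq_iff_eq_mul₀ hf]
  refine congrFun (coeff_eq_of_hasSum hmom (d := fun p => (t.factorial : ℂ) *
      complexMultivariateGamma 2 a * ∑ t₁ ∈ Finset.Icc ⌈(t : ℝ) / 2⌉₊ t,
        pochhammer a t₁ * pochhammer (a - 1) (t - t₁) * (2 * (t₁ : ℂ) + 1 - t) /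
          (((t₁ + 1).factorial : ℂ) * ((t - t₁).factorial : ℂ)) *
        ∑ i ∈ Finset.range (ceilBound t t₁ + 1), ((-1) ^ i * 4 ^ i * (cosEsymm t t₁ i : ℂ)) *
          ((hermDet u : ℂ) ^ (-((t₁ : ℂ) - i + a)) *
            ∑ k ∈ Finset.range (p + 1), (((2 * t₁ - t - 2 * i).choose k : ℂ) *
              ((u.1 + u.2.1 : ℝ) : ℂ) ^ (2 * t₁ - t - 2 * i - k) *
                (-((b.1 + b.2.1 : ℝ) : ℂ)) ^ k) *
              gegenbauerForm (p - k) ((t₁ : ℂ) - i + a)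
                ((hermMixedDet u b / hermDet u : ℝ) : ℂ) ((hermDet b / hermDet u : ℝ) : ℂ))) ?_) p
  have hsmall : ∀ᶠ z : ℝ in nhds 0,
      ‖(z : ℂ)‖ * ‖((hermMixedDet u b / hermDet u : ℝ) : ℂ)‖ +
        ‖(z : ℂ)‖ ^ 2 * ‖((hermDet b / hermDet u : ℝ) : ℂ)‖ < 1 := by
    have h : Continuous fun z : ℝ => ‖(z : ℂ)‖ * ‖((hermMixedDet u b / hermDet u : ℝ) : ℂ)‖ +
        ‖(z : ℂ)‖ ^ 2 * ‖((hermDet b / hermDet u : ℝ) : ℂ)‖ := by fun_prop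
    exact h.continuousAt.eventually_lt continuousAt_const (by simp)
  filter_upwards [eventually_sub_smul_mem hu b, hsmall] with z hz h1
  have hz2 := ((mem_posDefTwo_iff _).1 hz).2
  have hdet : hermDet (u - z • b) = hermDet u *
      (1 - (hermMixedDet u b / hermDet u * z - hermDet b / hermDet u * z ^ 2)) := by
    rw [hermDet_sub_smul]
    field_simp
    ring
  have hpos : 0 ≤ 1 - (hermMixedDet u b / hermDet u * z - hermDet b / hermDet u * z ^ 2) := by
    rw [hdet] at hz2
    exact (pos_of_mul_pos_right hz2 hd.le).le
  have hq : ∀ (m : ℕ) (ν : ℂ), HasSum (fun n => (z : ℂ) ^ n * ((hermDet u : ℂ) ^ (-ν) *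
        ∑ k ∈ Finset.range (n + 1), ((m.choose k : ℂ) * ((u.1 + u.2.1 : ℝ) : ℂ) ^ (m - k) *
            (-((b.1 + b.2.1 : ℝ) : ℂ)) ^ k) * gegenbauerForm (n - k) ν
                ((hermMixedDet u b / hermDet u : ℝ) : ℂ) ((hermDet b / hermDet u : ℝ) : ℂ)))
      ((((u - z • b).1 + (u - z • b).2.1 : ℝ) : ℂ) ^ m * (hermDet (u - z • b) : ℂ) ^ (-ν)) := by
    intro m ν
    have h := (hasSum_cauchy_product
      (hasSum_sub_mul_pow ((u.1 + u.2.1 : ℝ) : ℂ) ((b.1 + b.2.1 : ℝ) : ℂ) z m)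
      (hasSum_gegenbauerForm ν h1)).mul_left ((hermDet u : ℂ) ^ (-ν))
    rw [hdet, Complex.ofReal_mul, Complex.mul_cpow_ofReal_nonneg hd.le hpos]
    convert! h using 1
    · ext n
      ring
    · simp
      ring
  rw [integral_trace_moment hz ha t]
  have h := (hasSum_sum (s := Finset.Icc ⌈(t : ℝ) / 2⌉₊ t) fun t₁ _ =>
    (hasSum_sum (s := Finset.range (ceilBound t t₁ + 1)) fun i _ =>
      (hq (2 * t₁ - t - 2 * i) ((t₁ : ℂ) - i + a)).mul_left
        ((-1) ^ i * 4 ^ i * (cosEsymm t t₁ i : ℂ))).mul_left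
      (pochhammer a t₁ * pochhammer (a - 1) (t - t₁) * (2 * (t₁ : ℂ) + 1 - t) /
          (((t₁ + 1).factorial : ℂ) * ((t - t₁).factorial : ℂ)))).mul_left
      ((t.factorial : ℂ) * complexMultivariateGamma 2 a)
  convert! h using 1
  ext n
  rw [mul_left_comm]
  congr 1
  rw [Finset.mul_sum]
  refine Finset.sum_congr rfl fun t₁ _ => ?_
  rw [mul_left_comm]
  congr 1
  rw [Finset.mul_sum]
  exact Finset.sum_congr rfl fun i _ => mul_left_comm _ _ _

/-! ### Return to the matrix formulation -/

theorem trace_inv_mul_hermTwo (u b : ℝ × ℝ × ℂ) :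
    ((hermTwo u)⁻¹ * hermTwo b).trace = ((hermMixedDet u b / hermDet u : ℝ) : ℂ) := by
  rw [Matrix.inv_def, det_hermTwo, Ring.inverse_eq_inv', Matrix.smul_mul, Matrix.trace_smul,
    Matrix.adjugate_fin_two, smul_eq_mul, inv_mul_eq_div]
  push_cast
  congr 1
  simp only [hermTwo, hermMixedDet, Matrix.trace_fin_two, Matrix.mul_apply, Fin.sum_univ_two]
  apply Complex.ext <;> simp <;> ring

theorem det_inv_mul_hermTwo (u b : ℝ × ℝ × ℂ) :
    ((hermTwo u)⁻¹ * hermTwo b).det = ((hermDet b / hermDet u : ℝ) : ℂ) := by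
  rw [Matrix.det_mul, Matrix.det_nonsing_inv, Ring.inverse_eq_inv', det_hermTwo, det_hermTwo,
    inv_mul_eq_div]
  push_cast
  rfl

theorem gegenbauerForm_eq_gegenbauer {x y : ℝ} (hx : 0 < x) (hy : 0 < y) (n : ℕ) (ν c : ℂ) :
    gegenbauerForm n ν c ((y / x : ℝ) : ℂ) =
      (x : ℂ) ^ (-((n : ℂ) / 2)) * (y : ℂ) ^ ((n : ℂ) / 2) *
        gegenbauer n ν (c / (2 * ((y / x : ℝ) : ℂ) ^ (1 / 2 : ℂ))) := by
  have hyx : 0 < y / x := div_pos hy hx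
  have h0 : ((y / x : ℝ) : ℂ) ≠ 0 := by exact_mod_cast hyx.ne'
  have hs : ((y / x : ℝ) : ℂ) ^ (1 / 2 : ℂ) ≠ 0 := by
    rw [Complex.cpow_def_of_ne_zero h0]
    exact Complex.exp_ne_zero _
  have hsq : (((y / x : ℝ) : ℂ) ^ (1 / 2 : ℂ)) ^ 2 = ((y / x : ℝ) : ℂ) := by
    rw [← Complex.cpow_nat_mul]
    norm_num
  have hpow : (((y / x : ℝ) : ℂ) ^ (1 / 2 : ℂ)) ^ n =
      (x : ℂ) ^ (-((n : ℂ) / 2)) * (y : ℂ) ^ ((n : ℂ) / 2) := by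
    rw [← Complex.cpow_nat_mul, mul_one_div, Complex.cpow_neg, inv_mul_eq_div,
      eq_div_iff (by
        rw [Complex.cpow_def_of_ne_zero (by exact_mod_cast hx.ne')]
        exact Complex.exp_ne_zero _),
      ← Complex.mul_cpow_ofReal_nonneg hyx.le hx.le, ← Complex.ofReal_mul, div_mul_cancel₀ _ hx.ne']
  rw [← hpow, ← gegenbauerForm_sq hs, hsq]

theorem termB_hermTwo {u b : ℝ × ℝ × ℂ} (hu : u ∈ posDefTwo) (hb : b ∈ posDefTwo) (a : ℂ)
    (p t t₁ i : ℕ) :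
    (hermDet u : ℂ) ^ (-a) * termB (hermTwo u) (hermTwo b) a p t t₁ i =
      ((-1) ^ i * 4 ^ i * (cosEsymm t t₁ i : ℂ)) *
        ((hermDet u : ℂ) ^ (-((t₁ : ℂ) - i + a)) *
          ∑ k ∈ Finset.range (p + 1), (((2 * t₁ - t - 2 * i).choose k : ℂ) *
            ((u.1 + u.2.1 : ℝ) : ℂ) ^ (2 * t₁ - t - 2 * i - k) *
              (-((b.1 + b.2.1 : ℝ) : ℂ)) ^ k) *
            gegenbauerForm (p - k) ((t₁ : ℂ) - i + a)
              ((hermMixedDet u b / hermDet u : ℝ) : ℂ) ((hermDet b / hermDet u : ℝ) : ℂ)) := by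
  have hdu := ((mem_posDefTwo_iff u).1 hu).2
  have hdb := ((mem_posDefTwo_iff b).1 hb).2
  have hdu' : (hermDet u : ℂ) ≠ 0 := by exact_mod_cast hdu.ne'
  rw [termB, trace_inv_mul_hermTwo, det_inv_mul_hermTwo, trace_hermTwo, trace_hermTwo,
    det_hermTwo, det_hermTwo]
  generalize 2 * t₁ - t - 2 * i = m
  -- The Cauchy product runs to `k = p`, but `m.choose k` vanishes for `k > m`.
  rw [← Finset.sum_subset (s₁ := Finset.range (min p m + 1)) (s₂ := Finset.range (p + 1))]
  · rw [Finset.mul_sum, Finset.mul_sum, Finset.mul_sum]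
    refine Finset.sum_congr rfl fun k hk => ?_
    have hk : k ≤ p := by have := Finset.mem_range.1 hk; omega
    have e : (hermDet u : ℂ) ^ (-((t₁ : ℂ) - i) - ((p : ℂ) - k) / 2) * (hermDet u : ℂ) ^ (-a) =
        (hermDet u : ℂ) ^ (-((t₁ : ℂ) - i + a)) * (hermDet u : ℂ) ^ (-(((p : ℂ) - k) / 2)) := by
      rw [← Complex.cpow_add _ _ hdu', ← Complex.cpow_add _ _ hdu']
      congr 1
      ring
    rw [gegenbauerForm_eq_gegenbauer hdu hdb, Nat.cast_sub hk, neg_pow _ k, pow_add]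
    linear_combination ((-1) ^ k * (-1) ^ i * 4 ^ i * (cosEsymm t t₁ i : ℂ) * (m.choose k : ℂ) *
      ((u.1 + u.2.1 : ℝ) : ℂ) ^ (m - k) * ((b.1 + b.2.1 : ℝ) : ℂ) ^ k *
      (hermDet b : ℂ) ^ (((p : ℂ) - k) / 2) * gegenbauer (p - k) ((t₁ : ℂ) - i + a)
        (((hermMixedDet u b / hermDet u : ℝ) : ℂ) /
          (2 * ((hermDet b / hermDet u : ℝ) : ℂ) ^ (1 / 2 : ℂ)))) * e
  · intro k hk
    have := Finset.mem_range.1 hk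
    rw [Finset.mem_range]
    omega
  · intro k hk hk'
    have h1 := Finset.mem_range.1 hk
    rw [Finset.mem_range] at hk'
    rw [Nat.choose_eq_zero_of_lt (by omega)]
    simp

theorem integrand_hermTwo (u b : ℝ × ℝ × ℂ) (a : ℂ) (p t : ℕ) :
    (fun v : ℝ × ℝ × ℂ => etr (-(hermTwo u * hermTwo v)) * (hermTwo b * hermTwo v).trace ^ p *
        (hermTwo v).trace ^ t * (hermTwo v).det ^ (a - 2)) =
      fun v => Complex.exp (-(hermPairing u v : ℂ)) * ((hermPairing b v : ℂ) ^ p *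
        ((hermPairing (1, 1, 0) v : ℂ) ^ t * (hermDet v : ℂ) ^ (a - 2))) := by
  ext v
  rw [etr, Matrix.trace_neg, trace_hermTwo_mul, trace_hermTwo_mul, trace_hermTwo, det_hermTwo,
    hermPairing_one]
  ring

end

/-- For Hermitian positive definite `A`, `B` of size two, `p, t ∈ ℕ` and `Re a > 1`, the integral of
`etr(-AX) tr^p(BX) tr^t(X) |X|^(a-2)` over the positive definite cone converges absolutely and has
the stated value. -/
theorem lemma7 (A B : Matrix (Fin 2) (Fin 2) ℂ) (hA : A.PosDef) (hB : B.PosDef)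
    (p t : ℕ) (a : ℂ) (ha : 1 < a.re) :
    MeasureTheory.IntegrableOn
      (fun v : ℝ × ℝ × ℂ => etr (-(A * hermTwo v)) * (B * hermTwo v).trace ^ p *
        (hermTwo v).trace ^ t * (hermTwo v).det ^ (a - 2))
      posDefTwo MeasureTheory.volume ∧
    ∫ v in posDefTwo, etr (-(A * hermTwo v)) * (B * hermTwo v).trace ^ p *
        (hermTwo v).trace ^ t * (hermTwo v).det ^ (a - 2) =
      (p.factorial : ℂ) * (t.factorial : ℂ) * A.det ^ (-a) * complexMultivariateGamma 2 a *
        ∑ t₁ ∈ Finset.Icc ⌈(t : ℝ) / 2⌉₊ t,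
          pochhammer a t₁ * pochhammer (a - 1) (t - t₁) * (2 * (t₁ : ℂ) + 1 - t) /
            (((t₁ + 1).factorial : ℂ) * ((t - t₁).factorial : ℂ)) *
          ∑ i ∈ Finset.range (ceilBound t t₁ + 1), termB A B a p t t₁ i := by
  obtain ⟨u, rfl⟩ := exists_hermTwo_eq hA.isHermitian
  obtain ⟨b, rfl⟩ := exists_hermTwo_eq hB.isHermitian
  have hu : u ∈ posDefTwo := hA
  have hb : b ∈ posDefTwo := hB
  rw [integrand_hermTwo]
  -- Integrability is propagated twice from the gamma integrand: first with the identity for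
  -- `tr^t(X)`, then with `b` for `tr^p(BX)`.
  refine ⟨moment_integrableOn
    (g := fun v => (hermPairing (1, 1, 0) v : ℂ) ^ t * (hermDet v : ℂ) ^ (a - 2))
    (((Complex.measurable_ofReal.comp (measurable_hermPairing _)).pow_const t).mul
      (measurable_hermDet_cpow (a - 2)))
    (fun u hu => moment_integrableOn (measurable_hermDet_cpow (a - 2))
      (fun u hu => gammaIntegrand_integrableOn hu ha) hu trace_vec_mem t) hu hb p, ?_⟩
  rw [integral_pairing_trace_moment hu hb ha, det_hermTwo]
  simp_rw [← termB_hermTwo hu hb, ← Finset.mul_sum]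
  rw [Finset.sum_congr rfl fun t₁ _ => mul_left_comm _ ((hermDet u : ℂ) ^ (-a)) _,
    ← Finset.mul_sum]
  ring
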